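/- For a positive integer $n$, let $L_n$ be the ladder graph with vertices $p_1,\dots,p_n,q_1,\dots,q_n$ and edges $p_ip_{i+1}$, $q_iq_{i+1}$ $(1\le i\le n-1)$ and $p_iq_i$ $(1\le i\le n)$. Let $\Gamma$ be the metrized graph of which $L_n$ is a model with every edge of length $1$, that is, the union of unit segments, one for each edge, glued at the vertices. For a continuous piecewise affine $f:\Gamma\to\mathbb R$ put $\Delta f=\sum_{p\in\Gamma}\bigl(-\sum_{v}d_vf(p)\bigr)\delta_p$, where $v$ runs over the directions in which one can leave $p$ and $d_v f(p)$ is the one-sided derivative of $f$ at $p$ in the direction $v$. For $y,z\in\Gamma$ let $x\mapsto j_z(x,y)$ be the continuous piecewise affine function with $\Delta_x j_z(x,y)=\delta_y-\delta_z$ and $j_z(z,y)=0$ (the potential when unit current enters at $y$ and leaves at $z$, with $z$ grounded). For a signed Borel measure $\mu$ on $\Gamma$ put $$g_\mu(x,y)=\int j_\zeta(x,y)\,d\mu(\zeta)-\iiint j_\zeta(x',y')\,d\mu(\zeta)\,d\mu(x')\,d\mu(y').$$ A canonical measure is a signed Borel measure $\mu$ on $\Gamma$ with $\mu(\Gamma)=1$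 such that $g_\mu(x,x)$ is constant in $x\in\Gamma$, and the tau constant $\tau(L_n)$ is this constant value. Then for every integer $n\ge1$ a canonical measure on $\Gamma$ exists, and for every canonical measure the constant value equals $$\tau(L_n)=\frac{9n-20}{36}+\frac{n-6}{6\sqrt3}\left[1-\frac{2}{1-(2-\sqrt3)^{2n}}\right].$$ -/

import Mathlib

open MeasureTheory

/-! ## Metrized graphs with unit edge lengths -/

section MetrizedGraph

variable {V : Type*} [Fintype V] [DecidableEq V] (G : SimpleGraph V)

/-- The metrized graph modelled on the finite simple graph `G`, every edge having length `1`: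
the vertex `u` is the basis vector `Pi.single u 1` of `V → ℝ`, and the edge joining `u` and `v` is
the segment joining the vertices `u` and `v`, parametrised by arc length with `t ∈ [0, 1]`. It
carries the topology and the Borel sigma-algebra of a (compact) subspace of `V → ℝ`. -/
abbrev MetrizedGraph : Type _ :=
  {x : V → ℝ // (∃ u : V, x = Pi.single u 1) ∨
    ∃ u v : V, G.Adj u v ∧ ∃ t ∈ Set.Icc (0 : ℝ) 1, x = Pi.single u (1 - t) + Pi.single v t}

namespace MetrizedGraph

variable {G}

/-- The arc length parametrisation of an edge, oriented from `d.fst` to `d.snd`. -/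
def edgePath (d : G.Dart) (t : Set.Icc (0 : ℝ) 1) : MetrizedGraph G :=
  ⟨Pi.single d.fst (1 - (t : ℝ)) + Pi.single d.snd (t : ℝ),
    Or.inr ⟨d.fst, d.snd, d.adj, t, t.2, rfl⟩⟩

/-- A function on the metrized graph, read along an oriented edge as a function of the arc length
`t ∈ [0, 1]` (and extended by constants to `ℝ`). -/
noncomputable def alongEdge (f : MetrizedGraph G → ℝ) (d : G.Dart) : ℝ → ℝ :=
  Set.IccExtend zero_le_one (fun t => f (edgePath d t))

/-- Continuous, piecewise affine functions on the metrized graph. -/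
def IsCPA (f : MetrizedGraph G → ℝ) : Prop :=
  Continuous f ∧ ∀ d : G.Dart, ∃ S : Finset ℝ, ∀ t ∈ Set.Ioo (0 : ℝ) 1, t ∉ S →
    ∃ a b : ℝ, ∀ᶠ s in nhds t, alongEdge f d s = a * s + b

open Classical in
/-- The tangent directions at a point `p`: one for each oriented edge along which a path can leave
`p`. A vertex of degree `k` has `k` of them and an interior point of an edge has two. -/
noncomputable def tangentDirections (p : MetrizedGraph G) : Finset G.Dart :=
  Finset.univ.filter fun d => ∃ t : Set.Icc (0 : ℝ) 1, (t : ℝ) < 1 ∧ edgePath d t = p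

/-- The directional derivative of `f` at `p` in the direction of `d` (for `d` in
`tangentDirections p`, the position of `p` along `d` is its coordinate at `d.snd`). -/
noncomputable def dirDeriv (f : MetrizedGraph G → ℝ) (p : MetrizedGraph G) (d : G.Dart) : ℝ :=
  derivWithin (alongEdge f d) (Set.Ici (p.1 d.snd)) (p.1 d.snd)

/-- The mass at `p` of the Laplacian `Δ f = ∑ p, (- ∑ v, d_v f (p)) δ_p` of a continuous piecewise
affine function `f`. -/
noncomputable def laplacianMass (f : MetrizedGraph G → ℝ) (p : MetrizedGraph G) : ℝ :=
  - ∑ d ∈ tangentDirections p, dirDeriv f p d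

open Classical in
/-- `f` is the electric potential when unit current enters at `y` and leaves at `z`, and `z` is
grounded: `Δ f = δ_y - δ_z` and `f z = 0`, with `f` continuous and piecewise affine. -/
def IsVoltage (z y : MetrizedGraph G) (f : MetrizedGraph G → ℝ) : Prop :=
  IsCPA f ∧ f z = 0 ∧
    ∀ p, laplacianMass f p = (if p = y then 1 else 0) - (if p = z then 1 else 0)

open Classical in
/-- The voltage function `j_z(x, y)`: the potential at `x` when unit current enters at `y` and
leaves at `z`, and `z` is grounded. (The effective resistance is `r(x, y) = j_y(x, x)`.) -/
noncomputable def voltage (z x y : MetrizedGraph G) : ℝ :=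
  if h : ∃ f, IsVoltage z y f then h.choose x else 0

/-- `∫ j_ζ(x, y) dμ(ζ)` for a signed Borel measure `μ`. -/
noncomputable def voltageIntegral (μ : SignedMeasure (MetrizedGraph G))
    (x y : MetrizedGraph G) : ℝ :=
  ∫ᵛ ζ, voltage ζ x y ∂<•μ

/-- The Arakelov-Green function
`g_μ(x, y) = ∫ j_ζ(x, y) dμ(ζ) - ∫∫∫ j_ζ(x', y') dμ(ζ) dμ(x') dμ(y')`. -/
noncomputable def arakelovGreen (μ : SignedMeasure (MetrizedGraph G))
    (x y : MetrizedGraph G) : ℝ :=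
  voltageIntegral μ x y - ∫ᵛ y', (∫ᵛ x', voltageIntegral μ x' y' ∂<•μ) ∂<•μ

/-- A canonical measure: a signed Borel measure of total mass `1` whose Arakelov-Green function is
constant on the diagonal. -/
def IsCanonicalMeasure (μ : SignedMeasure (MetrizedGraph G)) : Prop :=
  μ Set.univ = 1 ∧ ∃ c : ℝ, ∀ x, arakelovGreen μ x x = c

end MetrizedGraph

/-- `c` is the tau constant of the metrized graph modelled on `G`: the constant value on the
diagonal of the Arakelov-Green function of the canonical measure. The canonical measure is required
to exist, and `c` has to be the value for every canonical measure, so that `c` is unique. -/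
def IsTauConstant (c : ℝ) : Prop :=
  (∃ μ : SignedMeasure (MetrizedGraph G), MetrizedGraph.IsCanonicalMeasure μ) ∧
    ∀ μ : SignedMeasure (MetrizedGraph G), MetrizedGraph.IsCanonicalMeasure μ →
      ∀ x, MetrizedGraph.arakelovGreen μ x x = c

end MetrizedGraph

/-- The ladder graph `L_n` with `n` rungs: vertices `p_i = (i, 0)` and `q_i = (i, 1)`, with edges
`p_i p_{i+1}`, `q_i q_{i+1}` and the rungs `p_i q_i`. -/
abbrev ladderGraph (n : ℕ) : SimpleGraph (Fin n × Fin 2) :=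
  SimpleGraph.boxProd (SimpleGraph.pathGraph n) (SimpleGraph.pathGraph 2)

/-!
The potential theory of a metrized graph `Γ` with unit edges reduces to finite matrices. A point of
`Γ` is its vector of barycentric coordinates `x : V → ℝ`, and if `H` is a symmetric Green matrix of
the graph Laplacian (`L (H · v) = δ_v - ρ` for a weight `ρ` of total mass `1`, with `H ρ` constant
equal to `k`), then
`g(x, y) = ∑ u v, x u * H u v * y v + ∑ {u, v} edge, min (x u) (y u) * min (x v) (y v)`
is a jointly continuous Green kernel on `Γ`: its Laplacian in `x` is `δ_y - ∑ u, ρ u δ_u`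
(`laplacianMass_greenKernel`). By the maximum principle voltages are unique on a connected graph,
so `j_z(x, y) = g(x, y) - g(x, z) - g(z, y) + g(z, z)` (`voltage_eq_greenKernel`), and
`g_μ(x, x) = g(x, x) - 2 ∫ g(x, ζ) dμ(ζ) + ∫∫ g dμ dμ` whenever `μ` has total mass `1`
(`arakelovGreen_self`). The symmetry of `g` and Fubini's theorem then show that all canonical
measures give the same constant (`arakelovGreen_self_eq`).

For the existence, take the measure with mass `1 - deg u / 2` at each vertex `u` and density
`1 - r(u, v)` on each edge, where `r(u, v)` is the effective resistance. The second order terms of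
`g(x, x)` and `2 ∫ g(x, ζ) dμ(ζ)` along the edges cancel, so the difference is affine on
every edge; at the vertices it is constant by a summation by parts for the graph Laplacian.
The integrals are explicit, and the tau constant comes out
(`isTauConstant_of_isGreenMatrix`) as
`∑ u, ρ u * H u u - k + 1/4 * ∑ (H u u - H v v) ^ 2 + 1/12 * ∑ (1 - r(u, v)) ^ 2`,
the last two sums running over the unoriented edges.

For the ladder, the Laplacian splits under the exchange of the two sides into the Laplacian of the
path, with Green matrix `-|i - j| / 2`, and the operator `L + 2` on the path, whose Green function
`screenedGreen` is built from the powers of `2 ± √3`, the roots of `X ^ 2 - 4 * X + 1`. Half the sum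
of the two, for vertices on the same side, and half the difference, for vertices on opposite sides,
give a Green matrix of the ladder (`isGreenMatrix_ladderGreen`), for which the sums over the edges
reduce to geometric series.
-/

set_option linter.unusedSectionVars false

/-! ### Barycentric coordinates -/

namespace MetrizedGraph

variable {V : Type*} [Fintype V] [DecidableEq V] {G : SimpleGraph V}

/-- The point of the metrized graph corresponding to the vertex `u`. -/
def vertexPt (G : SimpleGraph V) (u : V) : MetrizedGraph G :=
  ⟨Pi.single u 1, Or.inl ⟨u, rfl⟩⟩

lemma vertexPt_apply (u w : V) : (vertexPt G u).1 w = if w = u then 1 else 0 := by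
  simp [vertexPt, Pi.single_apply]

lemma edgePath_apply (d : G.Dart) (t : Set.Icc (0 : ℝ) 1) (w : V) :
    (edgePath d t).1 w =
      (if w = d.fst then 1 - (t : ℝ) else 0) + if w = d.snd then (t : ℝ) else 0 := by
  simp [edgePath, Pi.single_apply]

@[simp] lemma edgePath_fst (d : G.Dart) (t : Set.Icc (0 : ℝ) 1) :
    (edgePath d t).1 d.fst = 1 - (t : ℝ) := by
  simp [edgePath_apply, d.fst_ne_snd]

@[simp] lemma edgePath_snd (d : G.Dart) (t : Set.Icc (0 : ℝ) 1) :
    (edgePath d t).1 d.snd = (t : ℝ) := by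
  simp [edgePath_apply, d.fst_ne_snd.symm]

lemma edgePath_of_ne (d : G.Dart) (t : Set.Icc (0 : ℝ) 1) {w : V} (h₁ : w ≠ d.fst)
    (h₂ : w ≠ d.snd) : (edgePath d t).1 w = 0 := by
  simp [edgePath_apply, h₁, h₂]

lemma edgePath_zero (d : G.Dart) : edgePath d ⟨0, by simp⟩ = vertexPt G d.fst := by
  ext w; simp [edgePath_apply, vertexPt_apply]

lemma edgePath_one (d : G.Dart) : edgePath d ⟨1, by simp⟩ = vertexPt G d.snd := by
  ext w; simp [edgePath_apply, vertexPt_apply]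

lemma eq_vertexPt_or_edgePath (x : MetrizedGraph G) :
    (∃ u, x = vertexPt G u) ∨ ∃ (d : G.Dart) (t : Set.Icc (0 : ℝ) 1), x = edgePath d t := by
  obtain ⟨x, ⟨u, rfl⟩ | ⟨u, v, huv, t, ht, rfl⟩⟩ := x
  · exact Or.inl ⟨u, rfl⟩
  · exact Or.inr ⟨⟨(u, v), huv⟩, ⟨t, ht⟩, rfl⟩

lemma coord_nonneg (x : MetrizedGraph G) (u : V) : 0 ≤ x.1 u := by
  obtain ⟨v, rfl⟩ | ⟨d, t, rfl⟩ := eq_vertexPt_or_edgePath x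
  · rw [vertexPt_apply]; split_ifs <;> norm_num
  · rw [edgePath_apply]
    have := t.2.1; have := t.2.2
    split_ifs <;> linarith

lemma sum_coord (x : MetrizedGraph G) : ∑ u, x.1 u = 1 := by
  obtain ⟨v, rfl⟩ | ⟨d, t, rfl⟩ := eq_vertexPt_or_edgePath x
  · simp [vertexPt_apply]
  · simp [edgePath_apply, Finset.sum_add_distrib]

lemma coord_add_le_one (x : MetrizedGraph G) {u v : V} (h : u ≠ v) : x.1 u + x.1 v ≤ 1 := by
  have h1 : ∑ a ∈ {u, v}, x.1 a ≤ ∑ a, x.1 a :=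
    Finset.sum_le_sum_of_subset_of_nonneg (Finset.subset_univ _) fun w _ _ => coord_nonneg x w
  rwa [Finset.sum_pair h, sum_coord] at h1

/-- A point with two nonzero coordinates lies in the interior of an edge. -/
lemma adj_of_coord_ne_zero (x : MetrizedGraph G) {u v : V} (h : u ≠ v) (hu : x.1 u ≠ 0)
    (hv : x.1 v ≠ 0) : G.Adj u v ∧ x.1 u + x.1 v = 1 := by
  obtain ⟨w, rfl⟩ | ⟨d, t, rfl⟩ := eq_vertexPt_or_edgePath x
  · rw [vertexPt_apply] at hu hv
    grind
  · have hu' : u = d.fst ∨ u = d.snd := by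
      by_contra! H; exact hu (edgePath_of_ne d t H.1 H.2)
    have hv' : v = d.fst ∨ v = d.snd := by
      by_contra! H; exact hv (edgePath_of_ne d t H.1 H.2)
    rcases hu' with rfl | rfl <;> rcases hv' with rfl | rfl
    · exact absurd rfl h
    · exact ⟨d.adj, by simp⟩
    · exact ⟨d.adj.symm, by simp⟩
    · exact absurd rfl h

/-- If two coordinates add up to `1`, all the others vanish. -/
lemma coord_eq_zero_of_add_eq_one (x : MetrizedGraph G) {u v w : V} (h : u ≠ v)
    (hx : x.1 u + x.1 v = 1) (hu : w ≠ u) (hv : w ≠ v) : x.1 w = 0 := by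
  have h1 : ∑ a ∈ {w, u, v}, x.1 a ≤ ∑ a, x.1 a :=
    Finset.sum_le_sum_of_subset_of_nonneg (Finset.subset_univ _) fun w _ _ => coord_nonneg x w
  rw [Finset.sum_insert (by simp [hu, hv]), Finset.sum_pair h, sum_coord] at h1
  have := coord_nonneg x w
  linarith

lemma eq_edgePath_of_add_eq_one (x : MetrizedGraph G) (d : G.Dart)
    (h : x.1 d.fst + x.1 d.snd = 1) :
    x = edgePath d ⟨x.1 d.snd, coord_nonneg x _, by
      have := coord_nonneg x d.fst; linarith⟩ := by
  ext w
  by_cases h1 : w = d.fst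
  · subst h1; simp; linarith
  by_cases h2 : w = d.snd
  · subst h2; simp
  rw [edgePath_of_ne d _ h1 h2, coord_eq_zero_of_add_eq_one x d.fst_ne_snd h h1 h2]

lemma eq_vertexPt_of_coord_eq_one (x : MetrizedGraph G) {u : V} (h : x.1 u = 1) :
    x = vertexPt G u := by
  ext w
  rw [vertexPt_apply]
  split_ifs with hw
  · rw [hw, h]
  · have := coord_add_le_one x hw
    have := coord_nonneg x w
    linarith

lemma continuous_edgePath (d : G.Dart) : Continuous (edgePath d) := by
  refine Continuous.subtype_mk (continuous_pi fun w => ?_) _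
  have := fun t => edgePath_apply d t w
  simp only [edgePath] at this
  simp only [this]
  split_ifs <;> fun_prop

lemma continuous_coord (u : V) : Continuous fun x : MetrizedGraph G => x.1 u :=
  (continuous_apply u).comp continuous_subtype_val

/-- The metrized graph is the union of finitely many vertices and closed edges. -/
instance : CompactSpace (MetrizedGraph G) := by
  classical
  refine ⟨?_⟩
  have : (Set.univ : Set (MetrizedGraph G)) =
      Set.range (vertexPt G) ∪ ⋃ d : G.Dart, Set.range (edgePath d) := by
    refine (Set.eq_univ_of_forall fun x => ?_).symm
    obtain ⟨v, rfl⟩ | ⟨d, t, rfl⟩ := eq_vertexPt_or_edgePath x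
    · exact Or.inl ⟨v, rfl⟩
    · exact Or.inr (Set.mem_iUnion.2 ⟨d, t, rfl⟩)
  rw [this]
  exact (Set.finite_range _).isCompact.union
    (isCompact_iUnion fun d => isCompact_range (continuous_edgePath d))

/-! ### Directional derivatives of piecewise affine functions -/

lemma alongEdge_of_mem (f : MetrizedGraph G → ℝ) (d : G.Dart) {t : ℝ}
    (ht : t ∈ Set.Icc (0 : ℝ) 1) : alongEdge f d t = f (edgePath d ⟨t, ht⟩) :=
  Set.IccExtend_of_mem _ _ ht

lemma continuous_alongEdge {f : MetrizedGraph G → ℝ} (hf : Continuous f) (d : G.Dart) :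
    Continuous (alongEdge f d) :=
  (hf.comp (continuous_edgePath d)).Icc_extend'

lemma alongEdge_sub (f g : MetrizedGraph G → ℝ) (d : G.Dart) (t : ℝ) :
    alongEdge (fun x => f x - g x) d t = alongEdge f d t - alongEdge g d t := rfl

/-- A tangent direction at `p` is an oriented edge through `p` which does not end at `p`. -/
lemma mem_tangentDirections {p : MetrizedGraph G} {d : G.Dart} :
    d ∈ tangentDirections p ↔ p.1 d.fst ≠ 0 ∧ p.1 d.fst + p.1 d.snd = 1 := by
  simp only [tangentDirections, Finset.mem_filter, Finset.mem_univ, true_and]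
  constructor
  · rintro ⟨t, ht, rfl⟩
    simp; linarith
  · rintro ⟨h0, h1⟩
    refine ⟨_, ?_, (eq_edgePath_of_add_eq_one p d h1).symm⟩
    have := (coord_nonneg p d.fst).lt_of_ne' h0
    simp only; linarith

lemma coord_snd_mem {p : MetrizedGraph G} {d : G.Dart} (h : d ∈ tangentDirections p) :
    p.1 d.snd ∈ Set.Ico (0 : ℝ) 1 := by
  obtain ⟨h0, h1⟩ := mem_tangentDirections.1 h
  have := (coord_nonneg p d.fst).lt_of_ne' h0
  exact ⟨coord_nonneg p _, by linarith⟩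

lemma alongEdge_coord_snd (f : MetrizedGraph G → ℝ) {p : MetrizedGraph G} {d : G.Dart}
    (h : d ∈ tangentDirections p) : alongEdge f d (p.1 d.snd) = f p := by
  rw [alongEdge_of_mem f d (Set.Ico_subset_Icc_self (coord_snd_mem h))]
  congr 1
  exact (eq_edgePath_of_add_eq_one p d (mem_tangentDirections.1 h).2).symm

/-- The derivative in the direction `d` is the slope of any affine function which agrees with `f`
on an initial piece of the path leaving `p` along `d`. -/
lemma dirDeriv_eq {f : MetrizedGraph G → ℝ} {p : MetrizedGraph G} {d : G.Dart} {a b : ℝ}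
    (h : ∀ᶠ s in nhdsWithin (p.1 d.snd) (Set.Ici (p.1 d.snd)), alongEdge f d s = a * s + b) :
    dirDeriv f p d = a := by
  have h1 : HasDerivWithinAt (fun s : ℝ => a * s + b) a (Set.Ici (p.1 d.snd)) (p.1 d.snd) := by
    simpa using (((hasDerivAt_id (p.1 d.snd)).const_mul a).add_const b).hasDerivWithinAt
  have h2 := h1.congr_of_eventuallyEq h (h.self_of_nhdsWithin Set.self_mem_Ici)
  exact h2.derivWithin (uniqueDiffWithinAt_Ici _)

/-- A function which is affine near each point of an open interval is affine on it. -/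
lemma exists_affine_of_locally_affine {f : ℝ → ℝ} {c e : ℝ}
    (h : ∀ t ∈ Set.Ioo c e, ∃ a b : ℝ, ∀ᶠ s in nhds t, f s = a * s + b) :
    ∃ a b : ℝ, ∀ t ∈ Set.Ioo c e, f t = a * t + b := by
  have hder : ∀ t a b : ℝ, (∀ᶠ s in nhds t, f s = a * s + b) → HasDerivAt f a t := by
    intro t a b h
    have h1 : HasDerivAt (fun s : ℝ => a * s + b) a t := by
      simpa using ((hasDerivAt_id t).const_mul a).add_const b
    exact h1.congr_of_eventuallyEq h
  have hder2 : ∀ t ∈ Set.Ioo c e, HasDerivAt (deriv f) 0 t := by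
    intro t ht
    obtain ⟨a, b, hab⟩ := h t ht
    have h1 : ∀ᶠ s in nhds t, deriv f s = a := by
      filter_upwards [eventually_eventually_nhds.2 hab] with s hs
      exact (hder s a b hs).deriv
    exact (hasDerivAt_const t a).congr_of_eventuallyEq h1
  have hpre : IsPreconnected (Set.Ioo c e) := isPreconnected_Ioo
  obtain ⟨a, ha⟩ := isOpen_Ioo.exists_is_const_of_deriv_eq_zero hpre
    (fun t ht => (hder2 t ht).differentiableAt.differentiableWithinAt)
    (fun t ht => (hder2 t ht).deriv)
  have hder3 : ∀ t ∈ Set.Ioo c e, HasDerivAt (fun s => f s - a * s) 0 t := by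
    intro t ht
    obtain ⟨a', b', hab⟩ := h t ht
    have h1 := hder t a' b' hab
    have h2 : a' = a := by rw [← h1.deriv]; exact ha t ht
    have h3 := h1.fun_sub ((hasDerivAt_id t).const_mul a)
    rwa [h2, mul_one, sub_self] at h3
  obtain ⟨b, hb⟩ := isOpen_Ioo.exists_is_const_of_deriv_eq_zero hpre
    (fun t ht => (hder3 t ht).differentiableAt.differentiableWithinAt)
    (fun t ht => (hder3 t ht).deriv)
  exact ⟨a, b, fun t ht => by linarith [hb t ht]⟩

/-- A continuous piecewise affine function is affine on an initial piece of every path leaving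
a point along an edge. -/
lemma IsCPA.eventually_affine {f : MetrizedGraph G → ℝ} (hf : IsCPA f) (d : G.Dart) {t : ℝ}
    (ht : t ∈ Set.Ico (0 : ℝ) 1) :
    ∃ a b : ℝ, ∀ᶠ s in nhdsWithin t (Set.Ici t), alongEdge f d s = a * s + b := by
  obtain ⟨S, hS⟩ := hf.2 d
  have h1 : ∀ᶠ s in nhdsWithin t (Set.Ioi t), s ∉ S := by
    have : ((S : Set ℝ) \ {t})ᶜ ∈ nhds t :=
      (S.finite_toSet.subset Set.sdiff_subset).isClosed.isOpen_compl.mem_nhds (by simp)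
    filter_upwards [mem_nhdsWithin_of_mem_nhds this, self_mem_nhdsWithin] with s hs hst hsS
    exact hs ⟨hsS, ne_of_gt hst⟩
  have h2 : ∀ᶠ s in nhdsWithin t (Set.Ioi t), s ∉ S ∧ s < 1 :=
    h1.and (mem_nhdsWithin_of_mem_nhds (Iio_mem_nhds ht.2))
  obtain ⟨e, hte, he⟩ := (mem_nhdsGT_iff_exists_Ioo_subset).1 h2
  obtain ⟨a, b, hab⟩ := exists_affine_of_locally_affine (f := alongEdge f d) fun s hs =>
    hS s ⟨lt_of_le_of_lt ht.1 hs.1, (he hs).2⟩ (he hs).1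
  refine ⟨a, b, ?_⟩
  have h3 : ∀ᶠ s in nhdsWithin t (Set.Ioi t), alongEdge f d s = a * s + b := by
    filter_upwards [Ioo_mem_nhdsGT hte] with s hs using hab s hs
  -- the affine formula extends to `t` itself by continuity
  have h4 : alongEdge f d t = a * t + b := by
    have l1 := ((continuous_alongEdge hf.1 d).tendsto t).mono_left
      (nhdsWithin_le_nhds (s := Set.Ioi t))
    have l2 : Filter.Tendsto (fun s : ℝ => a * s + b) (nhdsWithin t (Set.Ioi t))
        (nhds (a * t + b)) :=
      (Continuous.tendsto (by fun_prop) t).mono_left nhdsWithin_le_nhds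
    exact tendsto_nhds_unique l1 (l2.congr' (h3.mono fun s hs => hs.symm))
  rw [← Set.Ioi_insert, nhdsWithin_insert]
  exact Filter.eventually_sup.2 ⟨by simpa using h4, h3⟩

lemma IsCPA.sub {f g : MetrizedGraph G → ℝ} (hf : IsCPA f) (hg : IsCPA g) :
    IsCPA fun x => f x - g x := by
  refine ⟨hf.1.sub hg.1, fun d => ?_⟩
  obtain ⟨S, hS⟩ := hf.2 d
  obtain ⟨T, hT⟩ := hg.2 d
  refine ⟨S ∪ T, fun t ht htn => ?_⟩
  simp only [Finset.mem_union, not_or] at htn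
  obtain ⟨a, b, h⟩ := hS t ht htn.1
  obtain ⟨a', b', h'⟩ := hT t ht htn.2
  refine ⟨a - a', b - b', ?_⟩
  filter_upwards [h, h'] with s h1 h2
  rw [alongEdge_sub, h1, h2]; ring

lemma IsCPA.add_const {f : MetrizedGraph G → ℝ} (hf : IsCPA f) (c : ℝ) :
    IsCPA fun x => f x + c := by
  refine ⟨hf.1.add continuous_const, fun d => ?_⟩
  obtain ⟨S, hS⟩ := hf.2 d
  refine ⟨S, fun t ht htn => ?_⟩
  obtain ⟨a, b, h⟩ := hS t ht htn
  refine ⟨a, b + c, ?_⟩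
  filter_upwards [h] with s h1
  rw [← add_assoc, ← h1]; rfl

lemma laplacianMass_sub {f g : MetrizedGraph G → ℝ} (hf : IsCPA f) (hg : IsCPA g)
    (p : MetrizedGraph G) :
    laplacianMass (fun x => f x - g x) p = laplacianMass f p - laplacianMass g p := by
  simp only [laplacianMass]
  rw [neg_sub_neg, ← neg_sub, neg_inj, ← Finset.sum_sub_distrib]
  refine Finset.sum_congr rfl fun d hd => ?_
  obtain ⟨a, b, h⟩ := hf.eventually_affine d (coord_snd_mem hd)
  obtain ⟨a', b', h'⟩ := hg.eventually_affine d (coord_snd_mem hd)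
  rw [dirDeriv_eq h, dirDeriv_eq h']
  refine dirDeriv_eq (b := b - b') ?_
  filter_upwards [h, h'] with s h1 h2
  rw [alongEdge_sub, h1, h2]; ring

lemma laplacianMass_add_const (f : MetrizedGraph G → ℝ) (c : ℝ) (p : MetrizedGraph G) :
    laplacianMass (fun x => f x + c) p = laplacianMass f p := by
  simp only [laplacianMass, dirDeriv]
  congr 1
  refine Finset.sum_congr rfl fun d _ => ?_
  exact derivWithin_add_const (f := alongEdge f d) (s := Set.Ici (p.1 d.snd)) c

/-! ### The maximum principle -/

/-- Where a harmonic function attains its maximum, it is constant on an initial piece of every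
path leaving the point: the directional derivatives there are nonpositive and add up to `0`. -/
lemma IsCPA.eventually_eq_max {f : MetrizedGraph G → ℝ} (hf : IsCPA f)
    {M : ℝ} (hM : ∀ x, f x ≤ M) {p : MetrizedGraph G} (h0 : laplacianMass f p = 0)
    (hp : f p = M) {d : G.Dart} (hd : d ∈ tangentDirections p) :
    ∀ᶠ s in nhdsWithin (p.1 d.snd) (Set.Ioi (p.1 d.snd)), alongEdge f d s = M := by
  have hle : ∀ (d : G.Dart) (s : ℝ), alongEdge f d s ≤ M := fun d s => hM _
  have hnonpos : ∀ d ∈ tangentDirections p, dirDeriv f p d ≤ 0 := by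
    intro d hd
    obtain ⟨a, b, h⟩ := hf.eventually_affine d (coord_snd_mem hd)
    rw [dirDeriv_eq h]
    have h1 := h.self_of_nhdsWithin Set.self_mem_Ici
    rw [alongEdge_coord_snd f hd, hp] at h1
    obtain ⟨s, hs, hs'⟩ := ((h.filter_mono (nhdsWithin_mono _ Set.Ioi_subset_Ici_self)).and
      self_mem_nhdsWithin).exists
    have h2 := hle d s
    rw [hs, h1] at h2
    have h3 : (0 : ℝ) < s - p.1 d.snd := sub_pos.2 hs'
    by_contra! ha
    nlinarith [mul_pos ha h3]
  have hzero : ∀ d ∈ tangentDirections p, dirDeriv f p d = 0 :=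
    (Finset.sum_eq_zero_iff_of_nonpos hnonpos).1 (neg_eq_zero.1 h0)
  obtain ⟨a, b, h⟩ := hf.eventually_affine d (coord_snd_mem hd)
  have ha : a = 0 := by rw [← dirDeriv_eq h]; exact hzero d hd
  have h1 := h.self_of_nhdsWithin Set.self_mem_Ici
  rw [alongEdge_coord_snd f hd, hp] at h1
  filter_upwards [h.filter_mono (nhdsWithin_mono _ Set.Ioi_subset_Ici_self)] with s hs
  rw [hs, h1, ha]; ring

/-- **Maximum principle**: a continuous piecewise affine function with zero Laplacian on a
connected metrized graph is constant. -/
theorem IsCPA.eq_of_laplacianMass_eq_zero (hG : G.Connected) {f : MetrizedGraph G → ℝ}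
    (hf : IsCPA f) (h0 : ∀ p, laplacianMass f p = 0) (x y : MetrizedGraph G) : f x = f y := by
  have := hG.nonempty
  have : Nonempty (MetrizedGraph G) := ⟨vertexPt G (Classical.arbitrary V)⟩
  obtain ⟨p₀, -, hp₀⟩ := isCompact_univ.exists_isMaxOn Set.univ_nonempty hf.1.continuousOn
  have hM : ∀ x, f x ≤ f p₀ := fun x => hp₀ (Set.mem_univ x)
  set M := f p₀ with hMdef
  -- if the maximum is attained at a point of an edge, it is attained on the whole way from there to
  -- either end: the set where it is attained is closed, and open to the right
  have hedge : ∀ (d : G.Dart) (t s : Set.Icc (0 : ℝ) 1), t ≤ s → f (edgePath d t) = M →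
      f (edgePath d s) = M := by
    intro d t s hts ht
    have hcl : IsClosed ({r | alongEdge f d r = M} ∩ Set.Icc (t : ℝ) 1) :=
      (isClosed_eq (continuous_alongEdge hf.1 d) continuous_const).inter isClosed_Icc
    have hsub := hcl.Icc_subset_of_forall_mem_nhdsWithin
      (by rw [Set.mem_ofPred_eq, alongEdge_of_mem f d t.2]; exact ht) (by
        rintro r ⟨hr, hr1, hr2⟩
        have hr' : r ∈ Set.Icc (0 : ℝ) 1 := ⟨t.2.1.trans hr1, hr2.le⟩
        have hd : d ∈ tangentDirections (edgePath d ⟨r, hr'⟩) := by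
          rw [mem_tangentDirections]; simp; linarith
        have hr3 : f (edgePath d ⟨r, hr'⟩) = M := by rw [← alongEdge_of_mem f d hr']; exact hr
        have := hf.eventually_eq_max hM (h0 _) hr3 hd
        rw [edgePath_snd] at this
        exact this)
    have := hsub (a := (s : ℝ)) ⟨hts, s.2.2⟩
    rw [Set.mem_ofPred_eq, alongEdge_of_mem f d s.2] at this
    exact this
  have hadj : ∀ u v, G.Adj u v → f (vertexPt G u) = M → f (vertexPt G v) = M := by
    intro u v huv hu
    have := hedge ⟨(u, v), huv⟩ ⟨0, by simp⟩ ⟨1, by simp⟩ (by simp)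
    rw [edgePath_zero, edgePath_one] at this
    exact this hu
  have hex : ∃ u, f (vertexPt G u) = M := by
    obtain ⟨v, hv⟩ | ⟨d, t, hd⟩ := eq_vertexPt_or_edgePath p₀
    · exact ⟨v, by rw [← hv]⟩
    · refine ⟨d.snd, ?_⟩
      rw [← edgePath_one]
      exact hedge d t _ t.2.2 (by rw [← hd])
  obtain ⟨u, hu⟩ := hex
  have hvert : ∀ v, f (vertexPt G v) = M := by
    intro v
    obtain ⟨w⟩ := hG.preconnected u v
    induction w with
    | nil => exact hu
    | cons h _ ih => exact ih (hadj _ _ h hu)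
  have hall : ∀ z, f z = M := by
    intro z
    obtain ⟨v, rfl⟩ | ⟨d, t, rfl⟩ := eq_vertexPt_or_edgePath z
    · exact hvert v
    · refine hedge d ⟨0, by simp⟩ t t.2.1 ?_
      rw [edgePath_zero]; exact hvert _
  rw [hall x, hall y]

lemma IsVoltage.unique (hG : G.Connected) {z y : MetrizedGraph G} {f g : MetrizedGraph G → ℝ}
    (hf : IsVoltage z y f) (hg : IsVoltage z y g) : f = g := by
  funext x
  have h := (hf.1.sub hg.1).eq_of_laplacianMass_eq_zero hG (fun p => by
    rw [laplacianMass_sub hf.1 hg.1, hf.2.2, hg.2.2, sub_self]) x z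
  simp only [hf.2.1, hg.2.1] at h
  linarith

lemma voltage_eq (hG : G.Connected) {z y : MetrizedGraph G} {f : MetrizedGraph G → ℝ}
    (hf : IsVoltage z y f) (x : MetrizedGraph G) : voltage z x y = f x := by
  have h : ∃ f, IsVoltage z y f := ⟨f, hf⟩
  rw [voltage, dif_pos h, h.choose_spec.unique hG hf]

end MetrizedGraph

/-! ### Green matrices and the Green kernel -/

namespace MetrizedGraph

variable {V : Type*} [Fintype V] [DecidableEq V] {G : SimpleGraph V}

open Classical in
/-- The Laplacian of the finite graph `G`: `(L f)(u) = ∑ w ~ u, (f u - f w)`. -/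
noncomputable def graphLaplacian (G : SimpleGraph V) (f : V → ℝ) (u : V) : ℝ :=
  ∑ w, if G.Adj u w then f u - f w else 0

/-- `H` is a symmetric Green matrix of the graph Laplacian of `G` relative to the weight `ρ` of
total mass `1` on the vertices: its columns satisfy `L (H · v) = δ_v - ρ`, and its potential
`H ρ` is the constant `k`. -/
structure IsGreenMatrix (G : SimpleGraph V) (H : V → V → ℝ) (ρ : V → ℝ) (k : ℝ) : Prop where
  symm : ∀ u v, H u v = H v u
  laplacian : ∀ u v, graphLaplacian G (fun w => H w v) u = (if u = v then 1 else 0) - ρ u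
  sum_weight : ∑ u, ρ u = 1
  potential : ∀ u, ∑ w, H u w * ρ w = k

open Classical in
lemma sum_dart_eq (F : V → V → ℝ) :
    ∑ d : G.Dart, F d.fst d.snd = ∑ u, ∑ w, if G.Adj u w then F u w else 0 := by
  rw [← Finset.sum_product', ← Finset.sum_filter]
  refine Finset.sum_bij' (fun d _ => d.toProd)
    (fun p hp => ⟨p, (Finset.mem_filter.1 hp).2⟩) ?_ ?_ ?_ ?_ ?_
  · simp
  · simp
  · simp
  · simp
  · simp

open Classical in
lemma sum_dart_fst_eq (u : V) (F : V → V → ℝ) :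
    ∑ d : G.Dart with d.fst = u, F d.fst d.snd = ∑ w, if G.Adj u w then F u w else 0 := by
  have h := sum_dart_eq (G := G) fun a b => if a = u then F a b else 0
  rw [Finset.sum_filter, h, Finset.sum_eq_single u]
  · simp
  · intro b _ hb; simp [hb]
  · simp

open Classical in
/-- The contribution of the edges to the Green kernel: if `x` and `y` lie on the same edge, at
distances `s` and `t` from one of its ends, this is `min s t * (1 - max s t)`, the Green function of
the unit segment with grounded ends; it is `0` otherwise. -/
noncomputable def tent (x y : MetrizedGraph G) : ℝ :=
  1 / 2 * ∑ d : G.Dart, min (x.1 d.fst) (y.1 d.fst) * min (x.1 d.snd) (y.1 d.snd)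

/-- The Green kernel on the metrized graph: the bilinear extension of the Green matrix `H` in the
barycentric coordinates, plus `tent`. Its Laplacian in `x` is `δ_y - ∑ u, ρ u δ_u`. -/
noncomputable def greenKernel (H : V → V → ℝ) (x y : MetrizedGraph G) : ℝ :=
  ∑ u, x.1 u * ∑ v, H u v * y.1 v + tent x y

lemma continuous_tent : Continuous fun p : MetrizedGraph G × MetrizedGraph G => tent p.1 p.2 := by
  classical
  have h1 : ∀ u, Continuous fun p : MetrizedGraph G × MetrizedGraph G => p.1.1 u :=
    fun u => (continuous_coord u).comp continuous_fst
  have h2 : ∀ u, Continuous fun p : MetrizedGraph G × MetrizedGraph G => p.2.1 u :=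
    fun u => (continuous_coord u).comp continuous_snd
  unfold tent
  exact continuous_const.mul (continuous_finsetSum _ fun d _ =>
    ((h1 _).min (h2 _)).mul ((h1 _).min (h2 _)))

lemma continuous_greenKernel (H : V → V → ℝ) :
    Continuous fun p : MetrizedGraph G × MetrizedGraph G => greenKernel H p.1 p.2 := by
  have h1 : ∀ u, Continuous fun p : MetrizedGraph G × MetrizedGraph G => p.1.1 u :=
    fun u => (continuous_coord u).comp continuous_fst
  have h2 : ∀ u, Continuous fun p : MetrizedGraph G × MetrizedGraph G => p.2.1 u :=
    fun u => (continuous_coord u).comp continuous_snd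
  unfold greenKernel
  refine Continuous.add (continuous_finsetSum _ fun u _ => (h1 u).mul
    (continuous_finsetSum _ fun v _ => continuous_const.mul (h2 v))) continuous_tent

lemma tent_comm (x y : MetrizedGraph G) : tent x y = tent y x := by
  simp only [tent, min_comm]

lemma greenKernel_comm {H : V → V → ℝ} (hH : ∀ u v, H u v = H v u) (x y : MetrizedGraph G) :
    greenKernel H x y = greenKernel H y x := by
  unfold greenKernel
  rw [tent_comm]
  congr 1
  simp only [Finset.mul_sum]
  rw [Finset.sum_comm]
  refine Finset.sum_congr rfl fun u _ => Finset.sum_congr rfl fun v _ => ?_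
  rw [hH]; ring

/-- A sum over the oriented edges whose terms vanish unless both ends lie on `d` reduces to the
two orientations of `d`. -/
lemma sum_dart_eq_add_symm [Fintype G.Dart] (d : G.Dart) (F : G.Dart → ℝ)
    (h₁ : ∀ e : G.Dart, e.fst ≠ d.fst → e.fst ≠ d.snd → F e = 0)
    (h₂ : ∀ e : G.Dart, e.snd ≠ d.fst → e.snd ≠ d.snd → F e = 0) :
    ∑ e, F e = F d + F d.symm := by
  classical
  rw [← Finset.sum_pair d.symm_ne.symm]
  refine (Finset.sum_subset (Finset.subset_univ _) fun e _ he => ?_).symm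
  by_contra hne
  have ha : e.fst = d.fst ∨ e.fst = d.snd := by
    by_contra! H; exact hne (h₁ e H.1 H.2)
  have hb : e.snd = d.fst ∨ e.snd = d.snd := by
    by_contra! H; exact hne (h₂ e H.1 H.2)
  have := e.fst_ne_snd
  apply he
  rw [Finset.mem_insert, Finset.mem_singleton]
  rcases ha with h1 | h1 <;> rcases hb with h2 | h2
  · exact absurd (h1.trans h2.symm) this
  · left; ext <;> simp [h1, h2]
  · right; ext <;> simp [h1, h2]
  · exact absurd (h1.trans h2.symm) this

lemma tent_edgePath (d : G.Dart) (t : Set.Icc (0 : ℝ) 1) (y : MetrizedGraph G) :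
    tent (edgePath d t) y = min (1 - (t : ℝ)) (y.1 d.fst) * min (t : ℝ) (y.1 d.snd) := by
  have hzero : ∀ w, w ≠ d.fst → w ≠ d.snd → min ((edgePath d t).1 w) (y.1 w) = 0 := by
    intro w h1 h2
    rw [edgePath_of_ne d t h1 h2]
    exact min_eq_left (coord_nonneg y w)
  classical
  rw [tent, sum_dart_eq_add_symm d]
  · simp only [SimpleGraph.Dart.symm_toProd, Prod.fst_swap, Prod.snd_swap]
    rw [edgePath_fst, edgePath_snd]
    ring
  · intro e h1 h2; rw [hzero _ h1 h2, zero_mul]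
  · intro e h1 h2; rw [hzero _ h1 h2, mul_zero]

lemma tent_vertexPt (u : V) (y : MetrizedGraph G) : tent (vertexPt G u) y = 0 := by
  classical
  rw [tent, Finset.sum_eq_zero, mul_zero]
  intro d _
  by_cases h : d.fst = u
  · have : d.snd ≠ u := fun h' => d.fst_ne_snd (h.trans h'.symm)
    rw [mul_eq_zero]; right
    rw [vertexPt_apply, if_neg this]
    exact min_eq_left (coord_nonneg y _)
  · rw [mul_eq_zero]; left
    rw [vertexPt_apply, if_neg h]
    exact min_eq_left (coord_nonneg y _)

/-- The potential at the vertex `u` of the Green kernel with pole at `y`. -/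
noncomputable def vertexPotential (H : V → V → ℝ) (y : MetrizedGraph G) (u : V) : ℝ :=
  ∑ v, H u v * y.1 v

lemma alongEdge_greenKernel (H : V → V → ℝ) (y : MetrizedGraph G) (d : G.Dart) {t : ℝ}
    (ht : t ∈ Set.Icc (0 : ℝ) 1) :
    alongEdge (fun x => greenKernel H x y) d t =
      (1 - t) * vertexPotential H y d.fst + t * vertexPotential H y d.snd +
        min (1 - t) (y.1 d.fst) * min t (y.1 d.snd) := by
  rw [alongEdge_of_mem _ d ht, greenKernel, tent_edgePath]
  congr 1
  simp only [edgePath_apply, add_mul, Finset.sum_add_distrib, ite_mul, zero_mul,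
    Finset.sum_ite_eq', Finset.mem_univ, if_true]
  rfl

lemma alongEdge_greenKernel_of_le (H : V → V → ℝ) (y : MetrizedGraph G) (d : G.Dart) {t : ℝ}
    (ht : t ∈ Set.Icc (0 : ℝ) 1) (h : t ≤ y.1 d.snd) :
    alongEdge (fun x => greenKernel H x y) d t =
      (vertexPotential H y d.snd - vertexPotential H y d.fst + y.1 d.fst) * t +
        vertexPotential H y d.fst := by
  rw [alongEdge_greenKernel H y d ht, min_eq_left h, min_eq_right]
  · ring
  · have := coord_add_le_one y d.fst_ne_snd
    linarith

/-- The case `y.1 d.fst = 0` is separate because `y` may then lie inside another edge at `d.snd`, where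
`y.1 d.snd` is positive but `tent` vanishes along `d`. -/
lemma alongEdge_greenKernel_of_ge (H : V → V → ℝ) (y : MetrizedGraph G) (d : G.Dart) {t : ℝ}
    (ht : t ∈ Set.Icc (0 : ℝ) 1) (h : y.1 d.snd ≤ t) :
    alongEdge (fun x => greenKernel H x y) d t =
      (vertexPotential H y d.snd - vertexPotential H y d.fst +
        if y.1 d.fst = 0 then 0 else -y.1 d.snd) * t +
        (vertexPotential H y d.fst + if y.1 d.fst = 0 then 0 else y.1 d.snd) := by
  rw [alongEdge_greenKernel H y d ht, min_eq_right h]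
  split_ifs with h0
  · rw [h0, min_eq_right (by linarith [ht.2])]; ring
  · by_cases h1 : y.1 d.snd = 0
    · rw [h1]; ring
    · have := (adj_of_coord_ne_zero y d.fst_ne_snd h0 h1).2
      rw [min_eq_left (by linarith)]; ring

lemma isCPA_greenKernel (H : V → V → ℝ) (y : MetrizedGraph G) :
    IsCPA fun x => greenKernel H x y := by
  refine ⟨(continuous_greenKernel H).comp (by fun_prop : Continuous fun x => (x, y)), fun d => ?_⟩
  refine ⟨{y.1 d.snd}, fun t ht htS => ?_⟩
  rw [Finset.mem_singleton] at htS
  have hI := Icc_mem_nhds ht.1 ht.2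
  rcases lt_or_gt_of_ne htS with h | h
  · refine ⟨vertexPotential H y d.snd - vertexPotential H y d.fst + y.1 d.fst,
      vertexPotential H y d.fst, ?_⟩
    filter_upwards [hI, Iio_mem_nhds h] with s hs hs'
    exact alongEdge_greenKernel_of_le H y d hs hs'.le
  · refine ⟨vertexPotential H y d.snd - vertexPotential H y d.fst +
        if y.1 d.fst = 0 then 0 else -y.1 d.snd,
      vertexPotential H y d.fst + if y.1 d.fst = 0 then 0 else y.1 d.snd, ?_⟩
    filter_upwards [hI, Ioi_mem_nhds h] with s hs hs'
    exact alongEdge_greenKernel_of_ge H y d hs hs'.le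

lemma dirDeriv_greenKernel (H : V → V → ℝ) (y : MetrizedGraph G) {p : MetrizedGraph G}
    {d : G.Dart} (hd : d ∈ tangentDirections p) :
    dirDeriv (fun x => greenKernel H x y) p d =
      vertexPotential H y d.snd - vertexPotential H y d.fst +
        if p.1 d.snd < y.1 d.snd then y.1 d.fst
        else if y.1 d.fst = 0 then 0 else -y.1 d.snd := by
  have hp := coord_snd_mem hd
  have hI : Set.Icc (0 : ℝ) 1 ∈ nhdsWithin (p.1 d.snd) (Set.Ici (p.1 d.snd)) := by
    filter_upwards [self_mem_nhdsWithin, mem_nhdsWithin_of_mem_nhds (Iio_mem_nhds hp.2)]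
      with s h1 h2
    exact ⟨hp.1.trans h1, le_of_lt h2⟩
  split_ifs with h h0
  · refine dirDeriv_eq (b := vertexPotential H y d.fst) ?_
    filter_upwards [hI, mem_nhdsWithin_of_mem_nhds (Iio_mem_nhds h)] with s hs hs'
    exact alongEdge_greenKernel_of_le H y d hs (le_of_lt hs')
  · refine dirDeriv_eq (b := vertexPotential H y d.fst + 0) ?_
    filter_upwards [hI, self_mem_nhdsWithin] with s hs hs'
    rw [alongEdge_greenKernel_of_ge H y d hs ((not_lt.1 h).trans hs'), if_pos h0, if_pos h0]
  · refine dirDeriv_eq (b := vertexPotential H y d.fst + y.1 d.snd) ?_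
    filter_upwards [hI, self_mem_nhdsWithin] with s hs hs'
    rw [alongEdge_greenKernel_of_ge H y d hs ((not_lt.1 h).trans hs'), if_neg h0, if_neg h0]

lemma laplacian_vertexPotential {H : V → V → ℝ} {ρ : V → ℝ} {k : ℝ}
    (hH : IsGreenMatrix G H ρ k) (y : MetrizedGraph G) (u : V) :
    graphLaplacian G (vertexPotential H y) u = y.1 u - ρ u := by
  classical
  have h : ∀ w, (if G.Adj u w then vertexPotential H y u - vertexPotential H y w else 0) =
      ∑ v, (if G.Adj u w then H u v - H w v else 0) * y.1 v := by
    intro w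
    split_ifs
    · simp only [vertexPotential, sub_mul, Finset.sum_sub_distrib]
    · simp
  simp only [graphLaplacian, h]
  rw [Finset.sum_comm]
  have h2 : ∀ v, (∑ w, (if G.Adj u w then H u v - H w v else 0) * y.1 v) =
      ((if u = v then 1 else 0) - ρ u) * y.1 v := by
    intro v
    rw [← Finset.sum_mul, ← hH.laplacian u v, graphLaplacian]
  simp only [h2, sub_mul, Finset.sum_sub_distrib, ← Finset.mul_sum, sum_coord]
  simp

open Classical in
/-- At a vertex `u`, the slopes of the vertex potentials contribute `y u - ρ u`, and the edges
contribute `- y u` if `y` is an interior point of an edge at `u`. -/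
lemma laplacianMass_greenKernel_vertexPt {H : V → V → ℝ} {ρ : V → ℝ} {k : ℝ}
    (hH : IsGreenMatrix G H ρ k) (y : MetrizedGraph G) (u : V) :
    laplacianMass (fun x => greenKernel H x y) (vertexPt G u) =
      (if vertexPt G u = y then 1 else 0) - ρ u := by
  have htan : tangentDirections (vertexPt G u) =
      Finset.univ.filter fun d : G.Dart => d.fst = u := by
    ext d
    rw [mem_tangentDirections, vertexPt_apply, vertexPt_apply]
    have := d.fst_ne_snd
    simp only [Finset.mem_filter, Finset.mem_univ, true_and]
    constructor
    · rintro ⟨h, -⟩; by_contra h'; simp [h'] at h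
    · rintro rfl; simp [this.symm]
  have hslope : ∀ d ∈ tangentDirections (vertexPt G u),
      dirDeriv (fun x => greenKernel H x y) (vertexPt G u) d =
        vertexPotential H y d.snd - vertexPotential H y d.fst +
          if y.1 d.snd = 0 then 0 else y.1 d.fst := by
    intro d hd
    rw [dirDeriv_greenKernel H y hd]
    rw [htan, Finset.mem_filter] at hd
    have h0 : (vertexPt G u).1 d.snd = 0 := by
      rw [vertexPt_apply, if_neg fun h => d.fst_ne_snd (hd.2.trans h.symm)]
    rw [h0]
    rcases (coord_nonneg y d.snd).lt_or_eq with h | h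
    · rw [if_pos h, if_neg h.ne']
    · rw [if_neg h.not_lt, if_pos h.symm, ← h]; simp
  rw [laplacianMass, Finset.sum_congr rfl hslope, htan, Finset.sum_add_distrib,
    sum_dart_fst_eq u (fun a b => vertexPotential H y b - vertexPotential H y a),
    sum_dart_fst_eq u (fun a b => if y.1 b = 0 then 0 else y.1 a), neg_add]
  have h1 : -(∑ w, if G.Adj u w then vertexPotential H y w - vertexPotential H y u else 0) =
      y.1 u - ρ u := by
    rw [← laplacian_vertexPotential hH y u, graphLaplacian, ← Finset.sum_neg_distrib]
    refine Finset.sum_congr rfl fun w _ => ?_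
    split_ifs <;> ring
  rw [h1]
  have h2 : (∑ w, if G.Adj u w then (if y.1 w = 0 then 0 else y.1 u) else 0) =
      y.1 u - if vertexPt G u = y then 1 else 0 := by
    by_cases hy : vertexPt G u = y
    · rw [if_pos hy, ← hy, vertexPt_apply, if_pos rfl, sub_self]
      refine Finset.sum_eq_zero fun w _ => ?_
      split_ifs with ha hb
      · rfl
      · exact absurd (by rw [vertexPt_apply, if_neg ha.ne']) hb
      · rfl
    rw [if_neg hy, sub_zero]
    by_cases h0 : y.1 u = 0
    · rw [h0]; simp
    have hne : y.1 u ≠ 1 := fun h => hy (eq_vertexPt_of_coord_eq_one y h).symm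
    obtain ⟨v, hvu, hv⟩ : ∃ v, v ≠ u ∧ y.1 v ≠ 0 := by
      by_contra! hall
      apply hne
      have hs := sum_coord y
      rwa [Finset.sum_eq_single u (fun w _ hw => hall w hw) (by simp)] at hs
    obtain ⟨hadj, hsum⟩ := adj_of_coord_ne_zero y hvu.symm h0 hv
    rw [Finset.sum_eq_single v]
    · rw [if_pos hadj, if_neg hv]
    · intro w _ hwv
      by_cases hwu : w = u
      · simp [hwu]
      · rw [if_pos (coord_eq_zero_of_add_eq_one y hvu.symm hsum hwu hwv)]; simp
    · simp
  rw [h2]; ring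

open Classical in
/-- At an interior point `p` of an edge, the slopes of the linear interpolation cancel, and those of
`tent` add up to `-1` if `p = y` and to `0` otherwise. -/
lemma laplacianMass_greenKernel_interior (H : V → V → ℝ) (y : MetrizedGraph G)
    {p : MetrizedGraph G} {d : G.Dart} (h : p.1 d.fst + p.1 d.snd = 1) (h₁ : p.1 d.fst ≠ 0)
    (h₂ : p.1 d.snd ≠ 0) :
    laplacianMass (fun x => greenKernel H x y) p = if p = y then 1 else 0 := by
  have htan : tangentDirections p = {d, d.symm} := by
    ext e
    rw [mem_tangentDirections, Finset.mem_insert, Finset.mem_singleton]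
    constructor
    · rintro ⟨he0, he1⟩
      have key : ∀ w, p.1 w ≠ 0 → w = d.fst ∨ w = d.snd := by
        intro w hw
        by_contra! H
        exact hw (coord_eq_zero_of_add_eq_one p d.fst_ne_snd h H.1 H.2)
      have hne := e.fst_ne_snd
      have he2 : p.1 e.snd ≠ 0 := by
        intro h0
        have h3 : p.1 e.fst = 1 := by linarith
        rcases key _ he0 with h4 | h4 <;> rw [h4] at h3
        · exact h₂ (by linarith)
        · exact h₁ (by linarith)
      rcases key _ he0 with h3 | h3 <;> rcases key _ he2 with h4 | h4
      · exact absurd (h3.trans h4.symm) hne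
      · left; ext <;> simp [h3, h4]
      · right; ext <;> simp [h3, h4]
      · exact absurd (h3.trans h4.symm) hne
    · rintro (rfl | rfl)
      · exact ⟨h₁, h⟩
      · exact ⟨h₂, by simpa [add_comm] using h⟩
  rw [laplacianMass, Finset.sum_congr rfl fun e he => dirDeriv_greenKernel H y he, htan,
    Finset.sum_pair d.symm_ne.symm]
  simp only [SimpleGraph.Dart.symm_toProd, Prod.fst_swap, Prod.snd_swap]
  have hy1 := coord_nonneg y d.fst
  have hy2 := coord_nonneg y d.snd
  have hy3 := coord_add_le_one y d.fst_ne_snd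
  have hp1 := (coord_nonneg p d.fst).lt_of_ne' h₁
  have hp2 := (coord_nonneg p d.snd).lt_of_ne' h₂
  by_cases hpy : p = y
  · subst hpy
    simp [h₁, h₂]
    linarith
  · rw [if_neg hpy]
    by_cases ha : y.1 d.fst = 0
    · rw [ha]; simp [hp1.not_gt]
    by_cases hb : y.1 d.snd = 0
    · rw [hb]; simp [hp2.not_gt]
    have hy := (adj_of_coord_ne_zero y d.fst_ne_snd ha hb).2
    have hne : p.1 d.snd ≠ y.1 d.snd := by
      intro heq
      apply hpy
      rw [eq_edgePath_of_add_eq_one p d h, eq_edgePath_of_add_eq_one y d hy]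
      congr 2
    rcases lt_or_gt_of_ne hne with hlt | hlt
    · rw [if_pos hlt, if_neg (by linarith), if_neg hb]; ring
    · rw [if_neg (by linarith), if_neg ha, if_pos (by linarith)]; ring

open Classical in
/-- The Laplacian of the Green kernel with pole at `y` is `δ_y - ∑ u, ρ u δ_u`. -/
lemma laplacianMass_greenKernel {H : V → V → ℝ} {ρ : V → ℝ} {k : ℝ}
    (hH : IsGreenMatrix G H ρ k) (y p : MetrizedGraph G) :
    laplacianMass (fun x => greenKernel H x y) p =
      (if p = y then 1 else 0) - ∑ u, if p = vertexPt G u then ρ u else 0 := by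
  have hinj : ∀ u v, vertexPt G u = vertexPt G v ↔ u = v := by
    intro u v
    refine ⟨fun h => ?_, fun h => by rw [h]⟩
    have h1 := vertexPt_apply (G := G) u u
    rw [h, vertexPt_apply] at h1
    by_contra hne
    simp [hne] at h1
  have hvert : ∀ u, laplacianMass (fun x => greenKernel H x y) (vertexPt G u) =
      (if vertexPt G u = y then 1 else 0) -
        ∑ v, if vertexPt G u = vertexPt G v then ρ v else 0 := by
    intro u
    rw [laplacianMass_greenKernel_vertexPt hH]
    simp [hinj]
  by_cases hp : ∃ u, p = vertexPt G u
  · obtain ⟨u, rfl⟩ := hp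
    exact hvert u
  · obtain ⟨d, t, rfl⟩ := (eq_vertexPt_or_edgePath p).resolve_left hp
    rw [Finset.sum_eq_zero fun u _ => if_neg fun h => hp ⟨u, h⟩, sub_zero]
    refine laplacianMass_greenKernel_interior H y (d := d) (by simp) ?_ ?_
    · intro h0
      apply hp
      refine ⟨d.snd, eq_vertexPt_of_coord_eq_one _ ?_⟩
      rw [edgePath_fst] at h0
      rw [edgePath_snd]; linarith
    · intro h0
      apply hp
      refine ⟨d.fst, eq_vertexPt_of_coord_eq_one _ ?_⟩
      rw [edgePath_snd] at h0
      rw [edgePath_fst]; linarith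

/-- The voltage function in terms of the Green kernel. -/
theorem voltage_eq_greenKernel (hG : G.Connected) {H : V → V → ℝ} {ρ : V → ℝ} {k : ℝ}
    (hH : IsGreenMatrix G H ρ k) (z x y : MetrizedGraph G) :
    voltage z x y = greenKernel H x y - greenKernel H x z +
      (greenKernel H z z - greenKernel H z y) := by
  classical
  have hcpa := (isCPA_greenKernel H y).sub (isCPA_greenKernel H z)
  refine voltage_eq (f := fun x => greenKernel H x y - greenKernel H x z +
      (greenKernel H z z - greenKernel H z y)) hG ⟨hcpa.add_const _, by ring, fun p => ?_⟩ x
  rw [laplacianMass_add_const, laplacianMass_sub (isCPA_greenKernel H y) (isCPA_greenKernel H z),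
    laplacianMass_greenKernel hH, laplacianMass_greenKernel hH]
  ring

end MetrizedGraph

/-! ### Integration of continuous functions against signed measures -/

section CompactIntegration

variable {X : Type*} [TopologicalSpace X] [CompactSpace X] [T2Space X] [SecondCountableTopology X]
  [MeasurableSpace X] [BorelSpace X] (μ ν : SignedMeasure X)

instance isFiniteMeasure_variation : IsFiniteMeasure μ.variation := by
  rw [← SignedMeasure.totalVariation_eq_variation]; infer_instance

lemma Continuous.integrable_signedMeasure {f : X → ℝ} (hf : Continuous f) : μ.Integrable f :=
  hf.integrable_of_hasCompactSupport (HasCompactSupport.of_compactSpace f)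

lemma integral_signedMeasure_add {f g : X → ℝ} (hf : Continuous f) (hg : Continuous g) :
    ∫ᵛ x, f x + g x ∂<•μ = ∫ᵛ x, f x ∂<•μ + ∫ᵛ x, g x ∂<•μ :=
  VectorMeasure.integral_fun_add (hf.integrable_signedMeasure μ) (hg.integrable_signedMeasure μ)

lemma integral_signedMeasure_sub {f g : X → ℝ} (hf : Continuous f) (hg : Continuous g) :
    ∫ᵛ x, f x - g x ∂<•μ = ∫ᵛ x, f x ∂<•μ - ∫ᵛ x, g x ∂<•μ :=
  VectorMeasure.integral_fun_sub (hf.integrable_signedMeasure μ) (hg.integrable_signedMeasure μ)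

lemma integral_signedMeasure_const (c : ℝ) : ∫ᵛ _ : X, c ∂<•μ = c * μ Set.univ := by
  rw [VectorMeasure.integral_const]; simp [mul_comm]

lemma integral_signedMeasure_const_mul (c : ℝ) (f : X → ℝ) :
    ∫ᵛ x, c * f x ∂<•μ = c * ∫ᵛ x, f x ∂<•μ :=
  VectorMeasure.integral_fun_smul μ _ c f

lemma integral_signedMeasure_eq_sub {f : X → ℝ} (hf : Continuous f) :
    ∫ᵛ x, f x ∂<•μ = ∫ x, f x ∂μ.toJordanDecomposition.posPart -
      ∫ x, f x ∂μ.toJordanDecomposition.negPart := by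
  conv_lhs => rw [← μ.toSignedMeasure_toJordanDecomposition]
  rw [JordanDecomposition.toSignedMeasure, VectorMeasure.integral_sub_vectorMeasure
    (hf.integrable_signedMeasure _) (hf.integrable_signedMeasure _),
    VectorMeasure.integral_toSignedMeasure, VectorMeasure.integral_toSignedMeasure]

lemma Continuous.integral_signedMeasure {g : X → X → ℝ}
    (hg : Continuous fun p : X × X => g p.1 p.2) : Continuous fun x => ∫ᵛ y, g x y ∂<•μ := by
  obtain ⟨C, hC⟩ := isCompact_univ.exists_bound_of_continuousOn hg.continuousOn
  have h1 : ∀ x, Continuous (g x) := fun x => hg.comp (by fun_prop : Continuous fun y => (x, y))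
  have h2 : ∀ y, Continuous fun x => g x y :=
    fun y => hg.comp (by fun_prop : Continuous fun x => (x, y))
  exact VectorMeasure.continuous_of_dominated (bound := fun _ => C)
    (fun x => (h1 x).aestronglyMeasurable)
    (fun x => Filter.Eventually.of_forall fun y => hC (x, y) (Set.mem_univ _))
    (integrable_const C) (Filter.Eventually.of_forall h2)

/-- Fubini's theorem for continuous functions and signed measures on a compact space. -/
lemma integral_signedMeasure_swap {g : X → X → ℝ}
    (hg : Continuous fun p : X × X => g p.1 p.2) :
    ∫ᵛ x, (∫ᵛ y, g x y ∂<•μ) ∂<•ν = ∫ᵛ y, (∫ᵛ x, g x y ∂<•ν) ∂<•μ := by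
  have h1 : ∀ x, Continuous (g x) := fun x => hg.comp (by fun_prop : Continuous fun y => (x, y))
  have h2 : ∀ y, Continuous fun x => g x y :=
    fun y => hg.comp (by fun_prop : Continuous fun x => (x, y))
  have hg' : Continuous fun p : X × X => g p.2 p.1 := hg.comp continuous_swap
  have hc : ∀ (m : Measure X) [IsFiniteMeasure m], Continuous fun x => ∫ y, g x y ∂m := by
    intro m _
    simpa using hg.integral_signedMeasure m.toSignedMeasure
  have hc' : ∀ (m : Measure X) [IsFiniteMeasure m], Continuous fun y => ∫ x, g x y ∂m := by
    intro m _
    simpa using Continuous.integral_signedMeasure m.toSignedMeasure hg'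
  have hi : ∀ (m : Measure X) [IsFiniteMeasure m] {f : X → ℝ}, Continuous f → Integrable f m :=
    fun m _ f hf => hf.integrable_of_hasCompactSupport (HasCompactSupport.of_compactSpace f)
  have hsw : ∀ (m n : Measure X) [IsFiniteMeasure m] [IsFiniteMeasure n],
      ∫ x, ∫ y, g x y ∂m ∂n = ∫ y, ∫ x, g x y ∂n ∂m := by
    intro m n _ _
    exact integral_integral_swap
      (hg.integrable_of_hasCompactSupport (HasCompactSupport.of_compactSpace _))
  rw [integral_signedMeasure_eq_sub ν (hg.integral_signedMeasure μ),
    integral_signedMeasure_eq_sub μ (Continuous.integral_signedMeasure ν hg')]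
  simp only [integral_signedMeasure_eq_sub μ (h1 _), integral_signedMeasure_eq_sub ν (h2 _)]
  rw [integral_sub (hi _ (hc _)) (hi _ (hc _)), integral_sub (hi _ (hc _)) (hi _ (hc _)),
    integral_sub (hi _ (hc' _)) (hi _ (hc' _)), integral_sub (hi _ (hc' _)) (hi _ (hc' _)),
    hsw, hsw, hsw, hsw]
  ring

end CompactIntegration

/-! ### The Arakelov-Green function in terms of the Green kernel -/

namespace MetrizedGraph

variable {V : Type*} [Fintype V] [DecidableEq V] {G : SimpleGraph V}

/-- On the diagonal, `g_μ(x, x) = g(x, x) - 2 ∫ g(x, ζ) dμ(ζ) + ∫∫ g dμ dμ` for the Green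
kernel `g`, whatever weight `g` is normalised by. -/
lemma arakelovGreen_self (hG : G.Connected) {H : V → V → ℝ} {ρ : V → ℝ} {k : ℝ}
    (hH : IsGreenMatrix G H ρ k) (μ : SignedMeasure (MetrizedGraph G)) (hμ : μ Set.univ = 1)
    (x : MetrizedGraph G) :
    arakelovGreen μ x x = greenKernel H x x - 2 * (∫ᵛ ζ, greenKernel H x ζ ∂<•μ) +
      ∫ᵛ y, (∫ᵛ ζ, greenKernel H y ζ ∂<•μ) ∂<•μ := by
  have hg := continuous_greenKernel (G := G) H
  have hx : ∀ x, Continuous fun y => greenKernel (G := G) H x y :=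
    fun x => hg.comp (by fun_prop : Continuous fun y => (x, y))
  have hy : ∀ y, Continuous fun x => greenKernel (G := G) H x y :=
    fun y => hg.comp (by fun_prop : Continuous fun x => (x, y))
  have hd : Continuous fun x => greenKernel (G := G) H x x :=
    hg.comp (by fun_prop : Continuous fun x => (x, x))
  have hP := hg.integral_signedMeasure μ
  set P : MetrizedGraph G → ℝ := fun x => ∫ᵛ ζ, greenKernel H x ζ ∂<•μ with hPdef
  set D : ℝ := ∫ᵛ ζ, greenKernel H ζ ζ ∂<•μ with hDdef
  have hvi : ∀ x y, voltageIntegral μ x y = greenKernel H x y - P x + (D - P y) := by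
    intro x y
    have h : ∀ ζ, voltage ζ x y = greenKernel H x y - greenKernel H x ζ +
        (greenKernel H ζ ζ - greenKernel H y ζ) := by
      intro ζ
      rw [voltage_eq_greenKernel hG hH, greenKernel_comm hH.symm ζ y]
    simp only [voltageIntegral, h]
    rw [integral_signedMeasure_add μ (by fun_prop) (by fun_prop),
      integral_signedMeasure_sub μ continuous_const (hx x), integral_signedMeasure_sub μ hd (hx y),
      integral_signedMeasure_const, hμ, mul_one]
  have hcomm : ∀ y, ∫ᵛ x, greenKernel H x y ∂<•μ = P y := by
    intro y
    simp only [hPdef, greenKernel_comm hH.symm y]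
  set J : ℝ := ∫ᵛ x, P x ∂<•μ with hJdef
  have h1 : ∀ y, ∫ᵛ x', voltageIntegral μ x' y ∂<•μ = D - J := by
    intro y
    simp only [hvi]
    rw [integral_signedMeasure_add μ (by fun_prop) continuous_const,
      integral_signedMeasure_sub μ (hy y) hP, hcomm,
      integral_signedMeasure_const, hμ]
    ring
  rw [arakelovGreen, hvi]
  simp only [h1]
  rw [integral_signedMeasure_const, hμ]
  ring

/-- Two canonical measures give the same constant. -/
lemma arakelovGreen_self_eq (hG : G.Connected) {H : V → V → ℝ} {ρ : V → ℝ} {k : ℝ}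
    (hH : IsGreenMatrix G H ρ k) {μ ν : SignedMeasure (MetrizedGraph G)}
    (hμ : μ Set.univ = 1) (hν : ν Set.univ = 1) {a b : ℝ}
    (ha : ∀ x, arakelovGreen μ x x = a) (hb : ∀ x, arakelovGreen ν x x = b) : a = b := by
  have hg := continuous_greenKernel (G := G) H
  simp only [arakelovGreen_self hG hH μ hμ] at ha
  simp only [arakelovGreen_self hG hH ν hν] at hb
  have hsw : ∫ᵛ x, (∫ᵛ y, greenKernel H x y ∂<•μ) ∂<•ν =
      ∫ᵛ x, (∫ᵛ y, greenKernel H x y ∂<•ν) ∂<•μ := by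
    rw [integral_signedMeasure_swap μ ν hg]
    congr 1
    funext y
    congr 1
    funext x
    exact greenKernel_comm hH.symm x y
  have hPμ := hg.integral_signedMeasure μ
  have hPν := hg.integral_signedMeasure ν
  set P : MetrizedGraph G → ℝ := fun x => ∫ᵛ ζ, greenKernel H x ζ ∂<•μ
  set Q : MetrizedGraph G → ℝ := fun x => ∫ᵛ ζ, greenKernel H x ζ ∂<•ν
  set J : ℝ := ∫ᵛ x, P x ∂<•μ with hJdef
  set K : ℝ := ∫ᵛ x, Q x ∂<•ν
  have hPQ : ∀ x, P x = Q x + (J - a - (K - b)) / 2 := by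
    intro x
    linarith [ha x, hb x]
  have h1 : J = ∫ᵛ x, Q x ∂<•μ + (J - a - (K - b)) / 2 := by
    conv_lhs => rw [hJdef, funext hPQ]
    rw [integral_signedMeasure_add μ hPν continuous_const, integral_signedMeasure_const, hμ,
      mul_one]
  have h2 : ∫ᵛ x, P x ∂<•ν = K + (J - a - (K - b)) / 2 := by
    conv_lhs => rw [funext hPQ]
    rw [integral_signedMeasure_add ν hPν continuous_const, integral_signedMeasure_const, hν,
      mul_one]
  linarith

/-- A measure of total mass `1` for which `g(x, x) - 2 ∫ g(x, ζ) dμ(ζ)` is constant is canonical,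
and it determines the tau constant. -/
theorem isTauConstant_of_measure (hG : G.Connected) {H : V → V → ℝ} {ρ : V → ℝ} {k : ℝ}
    (hH : IsGreenMatrix G H ρ k) (μ : SignedMeasure (MetrizedGraph G)) (hμ : μ Set.univ = 1)
    {φ : ℝ} (hφ : ∀ x, greenKernel H x x - 2 * (∫ᵛ ζ, greenKernel H x ζ ∂<•μ) = φ) :
    IsTauConstant G ((φ + ∫ᵛ x, greenKernel H x x ∂<•μ) / 2) := by
  have hg := continuous_greenKernel (G := G) H
  have hd : Continuous fun x => greenKernel (G := G) H x x :=
    hg.comp (by fun_prop : Continuous fun x => (x, x))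
  have hP := hg.integral_signedMeasure μ
  have hJ : ∫ᵛ x, greenKernel H x x ∂<•μ =
      φ + 2 * ∫ᵛ y, (∫ᵛ ζ, greenKernel H y ζ ∂<•μ) ∂<•μ := by
    have h : ∀ x, greenKernel H x x = φ + 2 * ∫ᵛ ζ, greenKernel H x ζ ∂<•μ := by
      intro x; linarith [hφ x]
    conv_lhs => rw [funext h]
    rw [integral_signedMeasure_add μ continuous_const (by fun_prop),
      integral_signedMeasure_const_mul, integral_signedMeasure_const, hμ, mul_one]
  have hconst : ∀ x, arakelovGreen μ x x = (φ + ∫ᵛ x, greenKernel H x x ∂<•μ) / 2 := by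
    intro x
    rw [arakelovGreen_self hG hH μ hμ, hφ x, hJ]; ring
  refine ⟨⟨μ, hμ, _, hconst⟩, fun ν hν x => ?_⟩
  obtain ⟨hν1, b, hb⟩ := hν
  rw [hb x]
  exact arakelovGreen_self_eq hG hH hν1 hμ hb hconst

end MetrizedGraph

/-! ### The canonical measure -/

namespace MetrizedGraph

variable {V : Type*} [Fintype V] [DecidableEq V] {G : SimpleGraph V}

/-- Lebesgue measure on an edge, as a measure on the metrized graph. -/
noncomputable def edgeMeasure (d : G.Dart) : Measure (MetrizedGraph G) :=
  Measure.map (edgePath d) volume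

instance (d : G.Dart) : IsProbabilityMeasure (edgeMeasure d) :=
  Measure.isProbabilityMeasure_map (continuous_edgePath d).aemeasurable

lemma integral_edgeMeasure {f : MetrizedGraph G → ℝ} (hf : Continuous f) (d : G.Dart) :
    ∫ x, f x ∂(edgeMeasure d) = ∫ t in (0 : ℝ)..1, alongEdge f d t := by
  rw [edgeMeasure, integral_map (continuous_edgePath d).aemeasurable
    hf.aestronglyMeasurable, intervalIntegral.integral_of_le zero_le_one,
    ← integral_Icc_eq_integral_Ioc, ← integral_subtype_comap measurableSet_Icc]
  refine integral_congr_ae (Filter.Eventually.of_forall fun t => ?_)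
  exact (alongEdge_of_mem f d t.2).symm

/-- The effective resistance between the vertices `u` and `v` if `H` is a Green matrix. -/
def resistance (H : V → V → ℝ) (u v : V) : ℝ := H u u + H v v - 2 * H u v

lemma resistance_comm {H : V → V → ℝ} (hH : ∀ u v, H u v = H v u) (u v : V) :
    resistance H u v = resistance H v u := by
  rw [resistance, resistance, hH u v]; ring

open Classical in
/-- The canonical measure of the metrized graph, if `H` is a Green matrix: the mass at the vertex
`u` is `1 - deg u / 2`, and the density on an edge with ends `u`, `v` is `1 - r(u, v)`. The degrees
and the edges are both accounted for by the sum over oriented edges, which runs over each edge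
twice. -/
noncomputable def canonicalMeasure (G : SimpleGraph V) (H : V → V → ℝ) :
    SignedMeasure (MetrizedGraph G) :=
  ∑ u, (Measure.dirac (vertexPt G u)).toSignedMeasure +
    ∑ d : G.Dart, (((1 - resistance H d.fst d.snd) / 2) • (edgeMeasure d).toSignedMeasure -
      (1 / 2 : ℝ) • (Measure.dirac (vertexPt G d.fst)).toSignedMeasure)

open Classical in
lemma integral_canonicalMeasure (H : V → V → ℝ) {f : MetrizedGraph G → ℝ} (hf : Continuous f) :
    ∫ᵛ x, f x ∂<•(canonicalMeasure G H) = ∑ u, f (vertexPt G u) +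
      ∑ d : G.Dart, ((1 - resistance H d.fst d.snd) / 2 * (∫ t in (0 : ℝ)..1, alongEdge f d t) -
        1 / 2 * f (vertexPt G d.fst)) := by
  have hi := fun μ : SignedMeasure (MetrizedGraph G) => hf.integrable_signedMeasure μ
  rw [canonicalMeasure, VectorMeasure.integral_add_vectorMeasure (hi _) (hi _),
    VectorMeasure.integral_finsetSum_vectorMeasure fun _ _ => hi _,
    VectorMeasure.integral_finsetSum_vectorMeasure fun _ _ => hi _]
  congr 1
  · simp
  · refine Finset.sum_congr rfl fun d _ => ?_
    rw [VectorMeasure.integral_sub_vectorMeasure (hi _) (hi _),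
      VectorMeasure.integral_smul_vectorMeasure, VectorMeasure.integral_smul_vectorMeasure,
      VectorMeasure.integral_toSignedMeasure, VectorMeasure.integral_toSignedMeasure,
      integral_edgeMeasure hf, integral_dirac]
    rfl

/-! ### Identities for Green matrices -/

open Classical in
/-- Summation by parts. -/
lemma sum_mul_graphLaplacian (f g : V → ℝ) :
    ∑ u, f u * graphLaplacian G g u =
      1 / 2 * ∑ u, ∑ w, if G.Adj u w then (f u - f w) * (g u - g w) else 0 := by
  have h1 : ∑ u, f u * graphLaplacian G g u =
      ∑ u, ∑ w, if G.Adj u w then f u * (g u - g w) else 0 := by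
    simp only [graphLaplacian, Finset.mul_sum, mul_ite, mul_zero]
  have h2 : ∑ u, f u * graphLaplacian G g u =
      ∑ u, ∑ w, if G.Adj u w then f w * (g w - g u) else 0 := by
    rw [h1, Finset.sum_comm]
    simp only [G.adj_comm]
  have h3 : (∑ u, ∑ w, if G.Adj u w then (f u - f w) * (g u - g w) else 0) =
      (∑ u, ∑ w, if G.Adj u w then f u * (g u - g w) else 0) +
      ∑ u, ∑ w, if G.Adj u w then f w * (g w - g u) else 0 := by
    simp only [← Finset.sum_add_distrib]
    refine Finset.sum_congr rfl fun u _ => Finset.sum_congr rfl fun w _ => ?_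
    split_ifs <;> ring
  rw [h3, ← h1, ← h2]; ring

/-- The integral of the barycentric coordinate at `u` against the canonical measure, see
`integral_coord`. -/
noncomputable def vertexMass (G : SimpleGraph V) (H : V → V → ℝ) (ρ : V → ℝ) (u : V) : ℝ :=
  1 / 2 * graphLaplacian G (fun w => H w w) u + ρ u

namespace IsGreenMatrix

variable {H : V → V → ℝ} {ρ : V → ℝ} {k : ℝ} (hH : IsGreenMatrix G H ρ k)

include hH

open Classical in
lemma sum_resistance (u : V) :
    (∑ w, if G.Adj u w then resistance H u w else 0) = 2 - 2 * vertexMass G H ρ u := by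
  have h1 : (∑ w, if G.Adj u w then resistance H u w else 0) =
      2 * graphLaplacian G (fun w => H w u) u - graphLaplacian G (fun w => H w w) u := by
    simp only [graphLaplacian, Finset.mul_sum, ← Finset.sum_sub_distrib]
    refine Finset.sum_congr rfl fun w _ => ?_
    split_ifs
    · rw [resistance, hH.symm u w]; ring
    · ring
  rw [h1, hH.laplacian, if_pos rfl, vertexMass]; ring

lemma sum_vertexMass : ∑ u, vertexMass G H ρ u = 1 := by
  have := sum_mul_graphLaplacian (G := G) (fun _ => 1) fun w => H w w
  simp only [one_mul, sub_self, zero_mul, ite_self, Finset.sum_const_zero, mul_zero] at this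
  simp only [vertexMass, Finset.sum_add_distrib, ← Finset.mul_sum, this, hH.sum_weight]
  norm_num

lemma sum_mul_vertexMass (u : V) :
    ∑ w, H u w * vertexMass G H ρ w = 1 / 2 * (H u u - ∑ w, ρ w * H w w) + k := by
  have h1 : ∑ w, H u w * graphLaplacian G (fun w => H w w) w =
      ∑ w, H w w * graphLaplacian G (fun w => H w u) w := by
    simp only [hH.symm u]
    rw [sum_mul_graphLaplacian, sum_mul_graphLaplacian (fun w => H w w)]
    simp only [mul_comm]
  have h2 : ∑ w, H w w * graphLaplacian G (fun w => H w u) w =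
      H u u - ∑ w, ρ w * H w w := by
    simp only [hH.laplacian, mul_sub, Finset.sum_sub_distrib, mul_comm (ρ _)]
    simp
  rw [← h2, ← h1, ← hH.potential u, Finset.mul_sum, ← Finset.sum_add_distrib]
  refine Finset.sum_congr rfl fun w _ => ?_
  rw [vertexMass]; ring

open Classical in
lemma sum_diag_mul_vertexMass :
    ∑ u, H u u * vertexMass G H ρ u = (∑ u, ρ u * H u u) +
      1 / 4 * ∑ u, ∑ w, if G.Adj u w then (H u u - H w w) ^ 2 else 0 := by
  have h := sum_mul_graphLaplacian (G := G) (fun w => H w w) fun w => H w w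
  simp only [← sq] at h
  have h2 : ∑ u, H u u * vertexMass G H ρ u = (∑ u, ρ u * H u u) +
      1 / 2 * ∑ u, H u u * graphLaplacian G (fun w => H w w) u := by
    rw [Finset.mul_sum, ← Finset.sum_add_distrib]
    refine Finset.sum_congr rfl fun w _ => ?_
    rw [vertexMass]; ring
  rw [h2, h]; ring

/-! ### Integrals against the canonical measure -/

lemma integral_coord (w : V) :
    ∫ᵛ x, x.1 w ∂<•(canonicalMeasure G H) = vertexMass G H ρ w := by
  classical
  rw [integral_canonicalMeasure H (continuous_coord w)]
  have hint : ∀ d : G.Dart, ∫ t in (0 : ℝ)..1, alongEdge (fun x => x.1 w) d t =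
      ((if d.fst = w then 1 else 0) + if d.snd = w then 1 else 0) / 2 := by
    intro d
    have h : Set.EqOn (alongEdge (fun x : MetrizedGraph G => x.1 w) d)
        (fun t => (if d.fst = w then 1 else 0) * (1 - t) + (if d.snd = w then 1 else 0) * t)
        (Set.uIcc (0 : ℝ) 1) := by
      intro t ht
      rw [Set.uIcc_of_le zero_le_one] at ht
      simp only [alongEdge_of_mem _ d ht, edgePath_apply, eq_comm (a := w)]
      split_ifs <;> ring
    rw [intervalIntegral.integral_congr h, intervalIntegral.integral_add
      (Continuous.intervalIntegrable (by fun_prop) _ _)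
      (Continuous.intervalIntegrable (by fun_prop) _ _), intervalIntegral.integral_const_mul,
      intervalIntegral.integral_const_mul, intervalIntegral.integral_sub
      (Continuous.intervalIntegrable (by fun_prop) _ _)
      (Continuous.intervalIntegrable (by fun_prop) _ _), integral_id]
    simp only [intervalIntegral.integral_const, sub_zero, smul_eq_mul]
    ring
  simp only [hint, vertexPt_apply, eq_comm (a := w)]
  have h1 := sum_dart_eq (G := G) fun a b => (1 - resistance H a b) / 2 *
    (((if a = w then 1 else 0) + if b = w then 1 else 0) / 2) - 1 / 2 * if a = w then 1 else 0
  have h2 : ∀ a b, (if G.Adj a b then (1 - resistance H a b) / 2 *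
      (((if a = w then 1 else 0) + if b = w then 1 else 0) / 2) - 1 / 2 * (if a = w then 1 else 0)
      else 0) = (if a = w then (if G.Adj a b then -(1 + resistance H a b) / 4 else 0) else 0) +
        if b = w then (if G.Adj a b then (1 - resistance H a b) / 4 else 0) else 0 := by
    intro a b
    split_ifs <;> ring
  simp only [h1, h2, Finset.sum_add_distrib]
  have h6 : ∀ a,
      (∑ b, if a = w then (if G.Adj a b then -(1 + resistance H a b) / 4 else 0) else 0) =
      if a = w then (∑ b, if G.Adj a b then -(1 + resistance H a b) / 4 else 0) else 0 := by
    intro a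
    split_ifs
    · rfl
    · simp
  simp only [h6, if_true, Finset.sum_ite_eq', Finset.mem_univ]
  have h3 : ∀ a, (if G.Adj a w then (1 - resistance H a w) / 4 else 0) =
      if G.Adj w a then (1 - resistance H w a) / 4 else 0 := by
    intro a
    have : resistance H a w = resistance H w a := by
      exact resistance_comm hH.symm a w
    rw [this, G.adj_comm]
  simp only [h3]
  have h4 := hH.sum_resistance w
  rw [← Finset.sum_add_distrib]
  have h5 : ∀ a, ((if G.Adj w a then -(1 + resistance H w a) / 4 else 0) +
      if G.Adj w a then (1 - resistance H w a) / 4 else 0) =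
      -(1 / 2) * if G.Adj w a then resistance H w a else 0 := by
    intro a; split_ifs <;> ring
  simp only [h5, ← Finset.mul_sum, h4]
  ring

lemma integral_linear (c : V → ℝ) :
    ∫ᵛ x, ∑ w, c w * x.1 w ∂<•(canonicalMeasure G H) = ∑ w, c w * vertexMass G H ρ w := by
  have h : ∀ w, Continuous fun x : MetrizedGraph G => c w * x.1 w :=
    fun w => continuous_const.mul (continuous_coord w)
  rw [VectorMeasure.integral_finsetSum _ fun w _ => (h w).integrable_signedMeasure _]
  simp only [integral_signedMeasure_const_mul, hH.integral_coord]

lemma canonicalMeasure_univ : canonicalMeasure G H Set.univ = 1 := by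
  have h := hH.integral_linear fun _ => 1
  simp only [one_mul, sum_coord, integral_signedMeasure_const, hH.sum_vertexMass] at h
  exact h

end IsGreenMatrix

lemma intervalIntegral_min_mul_min {a b : ℝ} (ha : 0 ≤ a) (hb : 0 ≤ b)
    (h : a ≠ 0 → b ≠ 0 → a + b = 1) :
    ∫ t in (0 : ℝ)..1, min (1 - t) a * min t b = a * b / 2 := by
  have hzero : ∀ {f : ℝ → ℝ}, (∀ t ∈ Set.Icc (0 : ℝ) 1, f t = 0) → ∫ t in (0 : ℝ)..1, f t = 0 := by
    intro f hf
    rw [intervalIntegral.integral_congr (g := fun _ => 0)]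
    · simp
    · intro t ht
      rw [Set.uIcc_of_le zero_le_one] at ht
      exact hf t ht
  by_cases h1 : a = 0
  · rw [hzero fun t ht => by rw [h1, min_eq_right (by linarith [ht.2]), zero_mul], h1]; simp
  by_cases h2 : b = 0
  · rw [hzero fun t ht => by rw [h2, min_eq_right ht.1, mul_zero], h2]; simp
  have hab := h h1 h2
  obtain rfl : a = 1 - b := by linarith
  have hc : Continuous fun t : ℝ => min (1 - t) (1 - b) * min t b := by fun_prop
  rw [← intervalIntegral.integral_add_adjacent_intervals (b := b) (hc.intervalIntegrable _ _)
    (hc.intervalIntegrable _ _)]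
  have e1 : ∫ t in (0 : ℝ)..b, min (1 - t) (1 - b) * min t b = ∫ t in (0 : ℝ)..b, (1 - b) * t := by
    refine intervalIntegral.integral_congr fun t ht => ?_
    rw [Set.uIcc_of_le hb] at ht
    simp only [min_eq_left ht.2, min_eq_right (by linarith [ht.2] : 1 - b ≤ 1 - t)]
  have e2 : ∫ t in b..(1 : ℝ), min (1 - t) (1 - b) * min t b = ∫ t in b..(1 : ℝ), (1 - t) * b := by
    refine intervalIntegral.integral_congr fun t ht => ?_
    rw [Set.uIcc_of_le (by linarith)] at ht
    simp only [min_eq_right ht.1, min_eq_left (by linarith [ht.1] : 1 - t ≤ 1 - b)]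
  rw [e1, e2, intervalIntegral.integral_const_mul, intervalIntegral.integral_mul_const,
    intervalIntegral.integral_sub (by simp) (by simp), integral_id, integral_id]
  simp; ring

open Classical in
lemma integral_tent_canonicalMeasure (H : V → V → ℝ) (x : MetrizedGraph G) :
    ∫ᵛ y, tent x y ∂<•(canonicalMeasure G H) =
      1 / 4 * ∑ d : G.Dart, (1 - resistance H d.fst d.snd) * (x.1 d.fst * x.1 d.snd) := by
  have hx : Continuous fun y => tent x y :=
    continuous_tent.comp (by fun_prop : Continuous fun y => (x, y))
  rw [integral_canonicalMeasure H hx]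
  simp only [tent_comm x, tent_vertexPt, mul_zero, sub_zero, Finset.sum_const_zero, zero_add,
    Finset.mul_sum]
  refine Finset.sum_congr rfl fun d _ => ?_
  have h : ∫ t in (0 : ℝ)..1, alongEdge (fun y => tent y x) d t =
      x.1 d.fst * x.1 d.snd / 2 := by
    rw [← intervalIntegral_min_mul_min (coord_nonneg x _) (coord_nonneg x _)
      fun h1 h2 => (adj_of_coord_ne_zero x d.fst_ne_snd h1 h2).2]
    refine intervalIntegral.integral_congr fun t ht => ?_
    rw [Set.uIcc_of_le zero_le_one] at ht
    rw [alongEdge_of_mem _ d ht, tent_edgePath]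
  rw [h]; ring

open Classical in
/-- On the diagonal, the Green kernel is quadratic along each edge, the second order term being
governed by the density of the canonical measure. -/
lemma greenKernel_self {H : V → V → ℝ} (hH : ∀ u v, H u v = H v u) (x : MetrizedGraph G) :
    greenKernel H x x = ∑ u, H u u * x.1 u +
      1 / 2 * ∑ d : G.Dart, (1 - resistance H d.fst d.snd) * (x.1 d.fst * x.1 d.snd) := by
  obtain ⟨v, rfl⟩ | ⟨d, t, rfl⟩ := eq_vertexPt_or_edgePath x
  · rw [greenKernel, tent_vertexPt, Finset.sum_eq_zero (s := (Finset.univ : Finset G.Dart))]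
    · simp [vertexPt_apply]
    · intro d _
      rw [vertexPt_apply, vertexPt_apply]
      have := d.fst_ne_snd
      grind
  · have h1 := alongEdge_greenKernel H (edgePath d t) d t.2
    rw [alongEdge_of_mem _ d t.2] at h1
    rw [sum_dart_eq_add_symm d]
    · refine h1.trans ?_
      simp only [SimpleGraph.Dart.symm_toProd, Prod.fst_swap, Prod.snd_swap]
      rw [edgePath_fst, edgePath_snd, min_self, min_self]
      simp only [vertexPotential, edgePath_apply, mul_add, mul_ite, mul_zero,
        Finset.sum_add_distrib, Finset.sum_ite_eq', Finset.mem_univ, if_true, resistance,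
        hH d.snd d.fst]
      ring
    · intro e h1 h2; rw [edgePath_of_ne d t h1 h2]; ring
    · intro e h1 h2; rw [edgePath_of_ne d t h1 h2]; ring

open Classical in
lemma IsGreenMatrix.integral_greenKernel_self {H : V → V → ℝ} {ρ : V → ℝ} {k : ℝ}
    (hH : IsGreenMatrix G H ρ k) :
    ∫ᵛ x, greenKernel H x x ∂<•(canonicalMeasure G H) = ∑ u, H u u * vertexMass G H ρ u +
      1 / 12 * ∑ d : G.Dart, (1 - resistance H d.fst d.snd) ^ 2 := by
  have hq : Continuous fun x : MetrizedGraph G => 1 / 2 * ∑ d : G.Dart,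
      (1 - resistance H d.fst d.snd) * (x.1 d.fst * x.1 d.snd) :=
    continuous_const.mul (continuous_finsetSum _ fun d _ => continuous_const.mul
      ((continuous_coord _).mul (continuous_coord _)))
  have hl : Continuous fun x : MetrizedGraph G => ∑ u, H u u * x.1 u :=
    continuous_finsetSum _ fun u _ => continuous_const.mul (continuous_coord u)
  simp only [greenKernel_self hH.symm]
  rw [integral_signedMeasure_add _ hl hq, hH.integral_linear, integral_canonicalMeasure H hq]
  congr 1
  have hv : ∀ u : V, (1 / 2 * ∑ d : G.Dart, (1 - resistance H d.fst d.snd) *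
      ((vertexPt G u).1 d.fst * (vertexPt G u).1 d.snd)) = 0 := by
    intro u
    rw [Finset.sum_eq_zero, mul_zero]
    intro d _
    rw [vertexPt_apply, vertexPt_apply]
    have := d.fst_ne_snd
    grind
  simp only [hv, mul_zero, sub_zero, Finset.sum_const_zero, zero_add]
  rw [Finset.mul_sum]
  refine Finset.sum_congr rfl fun d _ => ?_
  have h : ∫ t in (0 : ℝ)..1, alongEdge (fun x => 1 / 2 * ∑ d : G.Dart,
      (1 - resistance H d.fst d.snd) * (x.1 d.fst * x.1 d.snd)) d t =
      ∫ t in (0 : ℝ)..1, (1 - resistance H d.fst d.snd) * (t - t ^ 2) := by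
    refine intervalIntegral.integral_congr fun t ht => ?_
    rw [Set.uIcc_of_le zero_le_one] at ht
    rw [alongEdge_of_mem _ d ht, sum_dart_eq_add_symm d]
    · simp only [SimpleGraph.Dart.symm_toProd, Prod.fst_swap, Prod.snd_swap]
      rw [edgePath_fst, edgePath_snd, resistance, resistance, hH.symm d.snd d.fst]
      ring
    · intro e h1 h2; rw [edgePath_of_ne d _ h1 h2]; ring
    · intro e h1 h2; rw [edgePath_of_ne d _ h1 h2]; ring
  rw [h, intervalIntegral.integral_const_mul, intervalIntegral.integral_sub (by simp)
    (by simp), integral_id, integral_pow]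
  norm_num
  ring

open Classical in
/-- The tau constant of a connected metrized graph in terms of a Green matrix. The double sums count
each edge twice. -/
theorem isTauConstant_of_isGreenMatrix (hG : G.Connected) {H : V → V → ℝ} {ρ : V → ℝ} {k : ℝ}
    (hH : IsGreenMatrix G H ρ k) :
    IsTauConstant G ((∑ u, ρ u * H u u) - k +
      1 / 8 * (∑ u, ∑ w, if G.Adj u w then (H u u - H w w) ^ 2 else 0) +
      1 / 24 * ∑ u, ∑ w, if G.Adj u w then (1 - resistance H u w) ^ 2 else 0) := by
  have hP : ∀ x : MetrizedGraph G, ∫ᵛ y, greenKernel H x y ∂<•(canonicalMeasure G H) =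
      1 / 2 * (∑ u, H u u * x.1 u - ∑ w, ρ w * H w w) + k +
      1 / 4 * ∑ d : G.Dart, (1 - resistance H d.fst d.snd) * (x.1 d.fst * x.1 d.snd) := by
    intro x
    have h1 : ∀ y : MetrizedGraph G, ∑ u, x.1 u * ∑ v, H u v * y.1 v =
        ∑ v, (∑ u, x.1 u * H u v) * y.1 v := by
      intro y
      simp only [Finset.mul_sum, Finset.sum_mul, mul_assoc]
      exact Finset.sum_comm
    simp only [greenKernel, h1]
    have hx : Continuous fun y => tent x y :=
      continuous_tent.comp (by fun_prop : Continuous fun y => (x, y))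
    have hl : Continuous fun y : MetrizedGraph G => ∑ v, (∑ u, x.1 u * H u v) * y.1 v :=
      continuous_finsetSum _ fun v _ => continuous_const.mul (continuous_coord v)
    rw [integral_signedMeasure_add _ hl hx, hH.integral_linear, integral_tent_canonicalMeasure]
    congr 1
    have h2 : ∑ w, (∑ u, x.1 u * H u w) * vertexMass G H ρ w =
        ∑ u, x.1 u * ∑ w, H u w * vertexMass G H ρ w := by
      simp only [Finset.mul_sum, Finset.sum_mul, mul_assoc]
      exact Finset.sum_comm
    rw [h2]
    have h3 : ∀ u, x.1 u * ∑ w, H u w * vertexMass G H ρ w =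
        1 / 2 * (H u u * x.1 u) + x.1 u * (k - 1 / 2 * ∑ w, ρ w * H w w) := by
      intro u; rw [hH.sum_mul_vertexMass]; ring
    simp only [h3, Finset.sum_add_distrib, ← Finset.mul_sum, ← Finset.sum_mul, sum_coord]
    ring
  have hφ : ∀ x : MetrizedGraph G, greenKernel H x x -
      2 * (∫ᵛ ζ, greenKernel H x ζ ∂<•(canonicalMeasure G H)) = (∑ u, ρ u * H u u) - 2 * k := by
    intro x
    rw [hP, greenKernel_self hH.symm]; ring
  have h := isTauConstant_of_measure hG hH _ hH.canonicalMeasure_univ hφ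
  rw [hH.integral_greenKernel_self, hH.sum_diag_mul_vertexMass,
    sum_dart_eq fun a b => (1 - resistance H a b) ^ 2] at h
  convert h using 1
  ring

end MetrizedGraph

/-! ### Sums over the edges of a ladder -/

open Classical in
lemma sum_pathGraph_adj (m : ℕ) (f : ℤ → ℝ) (i : Fin (m + 1)) :
    (∑ j : Fin (m + 1), if (SimpleGraph.pathGraph (m + 1)).Adj i j then f (j : ℕ) else 0) =
      (if (i : ℕ) < m then f ((i : ℕ) + 1) else 0) +
        if 0 < (i : ℕ) then f ((i : ℕ) - 1) else 0 := by
  have h : ∀ j : Fin (m + 1),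
      (if (SimpleGraph.pathGraph (m + 1)).Adj i j then f (j : ℕ) else 0) =
      (if (i : ℕ) + 1 = j then f (j : ℕ) else 0) + if (j : ℕ) + 1 = i then f (j : ℕ) else 0 := by
    intro j
    rw [SimpleGraph.pathGraph_adj]
    by_cases h1 : (i : ℕ) + 1 = j
    · have h2 : ¬(j : ℕ) + 1 = i := by omega
      simp [h1, h2]
    · by_cases h2 : (j : ℕ) + 1 = i <;> simp [h1, h2]
  simp only [h, Finset.sum_add_distrib]
  congr 1
  · split_ifs with hi
    · rw [Finset.sum_eq_single ⟨i + 1, by omega⟩]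
      · simp
      · intro j _ hj
        rw [if_neg fun h => hj (Fin.ext h.symm)]
      · simp
    · refine Finset.sum_eq_zero fun j _ => if_neg ?_
      omega
  · split_ifs with hi
    · rw [Finset.sum_eq_single ⟨i - 1, by omega⟩]
      · simp only
        rw [if_pos (by omega), Nat.cast_sub hi]; simp
      · intro j _ hj
        rw [if_neg fun h => hj (Fin.ext (by simp only; omega))]
      · simp
    · refine Finset.sum_eq_zero fun j _ => if_neg ?_
      omega

open Classical in
lemma sum_ladderGraph_adj (n : ℕ) (i : Fin n) (ε : Fin 2) (F : Fin n × Fin 2 → ℝ) :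
    (∑ w, if (ladderGraph n).Adj (i, ε) w then F w else 0) =
      (∑ j, if (SimpleGraph.pathGraph n).Adj i j then F (j, ε) else 0) + F (i, 1 - ε) := by
  rw [Fintype.sum_prod_type]
  have h : ∀ j, (∑ δ, if (ladderGraph n).Adj (i, ε) (j, δ) then F (j, δ) else 0) =
      (if (SimpleGraph.pathGraph n).Adj i j then F (j, ε) else 0) +
        if i = j then F (j, 1 - ε) else 0 := by
    intro j
    have key : ∀ δ, (if (ladderGraph n).Adj (i, ε) (j, δ) then F (j, δ) else 0) =
        (if ε = δ then (if (SimpleGraph.pathGraph n).Adj i j then F (j, ε) else 0) else 0) +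
        if δ = 1 - ε then (if i = j then F (j, 1 - ε) else 0) else 0 := by
      intro δ
      rw [SimpleGraph.boxProd_adj]
      fin_cases ε <;> fin_cases δ <;> by_cases h : i = j <;>
        simp [SimpleGraph.pathGraph_adj, h]
    simp only [key, Finset.sum_add_distrib, Finset.sum_ite_eq, Finset.sum_ite_eq',
      Finset.mem_univ, if_true]
  simp only [h, Finset.sum_add_distrib]
  simp

open Classical in
lemma sum_sum_pathGraph_adj (m : ℕ) (F : ℤ → ℤ → ℝ) (hF : ∀ i j, F i j = F j i) :
    (∑ i : Fin (m + 1), ∑ j : Fin (m + 1),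
      if (SimpleGraph.pathGraph (m + 1)).Adj i j then F (i : ℕ) (j : ℕ) else 0) =
      2 * ∑ i ∈ Finset.range m, F i (i + 1) := by
  simp only [fun i : Fin (m + 1) => sum_pathGraph_adj m (F (i : ℕ)) i]
  rw [Fin.sum_univ_eq_sum_range (fun i => (if i < m then F (i : ℕ) ((i : ℕ) + 1) else 0) +
        if 0 < i then F (i : ℕ) ((i : ℕ) - 1) else 0), Finset.sum_add_distrib,
    Finset.sum_range_succ, Finset.sum_range_succ', if_neg (lt_irrefl _), if_neg (lt_irrefl _),
    add_zero, add_zero, two_mul]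
  congr 1
  · exact Finset.sum_congr rfl fun i hi => if_pos (Finset.mem_range.1 hi)
  · refine Finset.sum_congr rfl fun i _ => ?_
    rw [if_pos (Nat.succ_pos i), hF]
    push_cast
    rw [add_sub_cancel_right]

/-- A sum over the oriented edges of the ladder, the summand being `F` on both sides and `R` on the
rungs. -/
lemma sum_sum_ladderGraph_adj (m : ℕ) (K : Fin (m + 1) × Fin 2 → Fin (m + 1) × Fin 2 → ℝ)
    (F : ℤ → ℤ → ℝ) (R : ℕ → ℝ) (hF : ∀ i j, F i j = F j i)
    (hK : ∀ i j ε, K (i, ε) (j, ε) = F (i : ℕ) (j : ℕ)) (hR : ∀ i ε, K (i, ε) (i, 1 - ε) = R i)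
    [DecidableRel (ladderGraph (m + 1)).Adj] :
    (∑ u, ∑ w, if (ladderGraph (m + 1)).Adj u w then K u w else 0) =
      4 * ∑ i ∈ Finset.range m, F i (i + 1) + 2 * ∑ i ∈ Finset.range (m + 1), R i := by
  classical
  have h : ∀ u : Fin (m + 1) × Fin 2, (∑ w, if (ladderGraph (m + 1)).Adj u w then K u w else 0) =
      (∑ j, if (SimpleGraph.pathGraph (m + 1)).Adj u.1 j then F (u.1 : ℕ) (j : ℕ) else 0) +
        R u.1 := by
    rintro ⟨i, ε⟩
    have := sum_ladderGraph_adj (m + 1) i ε (K (i, ε))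
    simp only [hK, hR] at this
    rw [← this]
    congr!
  simp only [h]
  rw [Fintype.sum_prod_type, ← Fin.sum_univ_eq_sum_range R]
  simp only [Finset.sum_const, Finset.card_univ, Fintype.card_fin, nsmul_eq_mul,
    ← Finset.mul_sum]
  rw [Finset.sum_add_distrib, sum_sum_pathGraph_adj m F hF]
  push_cast
  ring

/-! ### The sequences `(2 + √3) ^ k ± (2 + √3) ^ (-k)` -/

/-- `(2 + √3) ^ k + (2 + √3) ^ (-k)`, an even solution of `c (k + 1) + c (k - 1) = 4 * c k`. -/
noncomputable def ladderCosh (k : ℤ) : ℝ := (2 + √3) ^ k + (2 + √3) ^ (-k)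

/-- `(2 + √3) ^ k - (2 + √3) ^ (-k)`, an odd solution of `s (k + 1) + s (k - 1) = 4 * s k`. -/
noncomputable def ladderSinh (k : ℤ) : ℝ := (2 + √3) ^ k - (2 + √3) ^ (-k)

lemma sqrt_three_sq : √3 ^ 2 = (3 : ℝ) := Real.sq_sqrt (by norm_num)

lemma two_add_sqrt_three_ne_zero : (2 + √3 : ℝ) ≠ 0 := by positivity

lemma inv_two_add_sqrt_three : (2 + √3 : ℝ)⁻¹ = 2 - √3 :=
  inv_eq_of_mul_eq_one_right (by linear_combination -sqrt_three_sq)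

lemma ladderCosh_neg (k : ℤ) : ladderCosh (-k) = ladderCosh k := by
  rw [ladderCosh, ladderCosh, neg_neg, add_comm]

lemma ladderSinh_neg (k : ℤ) : ladderSinh (-k) = -ladderSinh k := by
  rw [ladderSinh, ladderSinh, neg_neg, neg_sub]

lemma ladderCosh_add_one (k : ℤ) :
    ladderCosh (k + 1) = 2 * ladderCosh k + √3 * ladderSinh k := by
  rw [ladderCosh, ladderCosh, ladderSinh, neg_add, zpow_add₀ two_add_sqrt_three_ne_zero,
    zpow_add₀ two_add_sqrt_three_ne_zero, zpow_neg_one, inv_two_add_sqrt_three, zpow_one]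
  ring

lemma ladderSinh_add_one (k : ℤ) :
    ladderSinh (k + 1) = 2 * ladderSinh k + √3 * ladderCosh k := by
  rw [ladderSinh, ladderCosh, ladderSinh, neg_add, zpow_add₀ two_add_sqrt_three_ne_zero,
    zpow_add₀ two_add_sqrt_three_ne_zero, zpow_neg_one, inv_two_add_sqrt_three, zpow_one]
  ring

lemma ladderCosh_sub_one (k : ℤ) :
    ladderCosh (k - 1) = 2 * ladderCosh k - √3 * ladderSinh k := by
  have h1 := ladderCosh_add_one (-k)
  rw [ladderCosh_neg, ladderSinh_neg, ← ladderCosh_neg] at h1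
  rw [show k - 1 = -(-k + 1) by ring, h1]; ring

lemma ladderSinh_sub_one (k : ℤ) :
    ladderSinh (k - 1) = 2 * ladderSinh k - √3 * ladderCosh k := by
  have h1 := ladderSinh_add_one (-k)
  rw [ladderCosh_neg, ladderSinh_neg] at h1
  rw [show k - 1 = -(-k + 1) by ring, ladderSinh_neg, h1]; ring

lemma ladderCosh_sq (k : ℤ) : ladderCosh k ^ 2 = ladderSinh k ^ 2 + 4 := by
  have : (2 + √3 : ℝ) ^ k * (2 + √3) ^ (-k) = 1 := by
    rw [← zpow_add₀ two_add_sqrt_three_ne_zero]; simp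
  rw [ladderCosh, ladderSinh]
  linear_combination 4 * this

lemma ladderCosh_two_mul (k : ℤ) : ladderCosh (2 * k) = ladderCosh k ^ 2 - 2 := by
  have : (2 + √3 : ℝ) ^ k * (2 + √3) ^ (-k) = 1 := by
    rw [← zpow_add₀ two_add_sqrt_three_ne_zero]; simp
  rw [ladderCosh, ladderCosh, two_mul, neg_add, zpow_add₀ two_add_sqrt_three_ne_zero,
    zpow_add₀ two_add_sqrt_three_ne_zero]
  linear_combination -2 * this

lemma ladderSinh_two_mul (k : ℤ) : ladderSinh (2 * k) = ladderSinh k * ladderCosh k := by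
  rw [ladderSinh, ladderSinh, ladderCosh, two_mul, neg_add, zpow_add₀ two_add_sqrt_three_ne_zero,
    zpow_add₀ two_add_sqrt_three_ne_zero]
  ring

lemma ladderSinh_pos {k : ℤ} (hk : 0 < k) : 0 < ladderSinh k := by
  rw [ladderSinh, sub_pos]
  exact zpow_lt_zpow_right₀ (by linarith [Real.sqrt_nonneg 3]) (by omega)

/-- The sum telescopes as `c k = (s (k + 1) - s (k - 1)) / (2 * √3)`. -/
lemma sum_ladderCosh (M : ℕ) (a : ℤ) :
    ∑ i ∈ Finset.range M, ladderCosh (2 * i + a) =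
      √3 / 6 * (ladderSinh (2 * M + a - 1) - ladderSinh (a - 1)) := by
  induction M with
  | zero => simp
  | succ M ih =>
    rw [Finset.sum_range_succ, ih]
    push_cast
    rw [show 2 * ((M : ℤ) + 1) + a - 1 = 2 * M + a + 1 by ring, ladderSinh_add_one,
      ladderSinh_sub_one (2 * M + a)]
    linear_combination -(1 / 3) * ladderCosh (2 * M + a) * sqrt_three_sq

/-- The sum telescopes as `c k ^ 2 = 2 + c (2 * k)` and
`c (2 * k) = (s (2 * k + 2) - s (2 * k - 2)) / (8 * √3)`. -/
lemma sum_ladderCosh_sq (M : ℕ) (a : ℤ) :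
    ∑ i ∈ Finset.range M, ladderCosh (2 * i + a) ^ 2 =
      2 * M + √3 / 24 * (ladderSinh (2 * (2 * M + a - 1)) - ladderSinh (2 * (a - 1))) := by
  induction M with
  | zero => simp
  | succ M ih =>
    rw [Finset.sum_range_succ, ih]
    have h := ladderCosh_two_mul (2 * M + a)
    push_cast
    rw [show 2 * (2 * ((M : ℤ) + 1) + a - 1) = 2 * (2 * M + a) + 1 + 1 by ring,
      show 2 * (2 * (M : ℤ) + a - 1) = 2 * (2 * M + a) - 1 - 1 by ring, ladderSinh_add_one,
      ladderSinh_sub_one (2 * (2 * M + a) - 1), ladderSinh_add_one, ladderSinh_sub_one,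
      ladderCosh_add_one, ladderCosh_sub_one]
    linear_combination -h - (1 / 3) * ladderCosh (2 * (2 * M + a)) * sqrt_three_sq

/-! ### A Green matrix of the ladder -/

/-- The Green function of the operator `L + 2` on the path with vertices `0, …, m`, where `L` is
the Laplacian of the path: for `i ≤ j`, the expanded product of the homogeneous solution with a free
end at `0`, taken at `i`, and the one with a free end at `m`, taken at `j`, over their Wronskian. -/
noncomputable def screenedGreen (m : ℕ) (i j : ℤ) : ℝ :=
  (ladderCosh (m + 1 - |i - j|) + ladderCosh (i + j - m)) / (2 * √3 * ladderSinh (m + 1))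

/-- A Green matrix of the ladder: `(A + B) / 2` for vertices on the same side and `(A - B) / 2`
otherwise, where `A i j = -|i - j| / 2` is a Green matrix of the path, relative to the weight with
mass `1 / 2` at both ends, and `B` is `screenedGreen`. -/
noncomputable def ladderGreen (m : ℕ) (x y : Fin (m + 1) × Fin 2) : ℝ :=
  -|(x.1 : ℝ) - (y.1 : ℝ)| / 4 +
    (if x.2 = y.2 then 1 else -1) * screenedGreen m (x.1 : ℕ) (y.1 : ℕ) / 2

/-- The weight putting mass `1 / 4` on each of the four corners of the ladder (and mass `1 / 2` on
each of the two vertices if there is only one rung). -/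
noncomputable def cornerWeight (m : ℕ) (x : Fin (m + 1) × Fin 2) : ℝ :=
  ((if (x.1 : ℕ) = 0 then 1 else 0) + if (x.1 : ℕ) = m then 1 else 0) / 4

lemma screenedGreen_comm (m : ℕ) (i j : ℤ) : screenedGreen m i j = screenedGreen m j i := by
  rw [screenedGreen, screenedGreen, abs_sub_comm, add_comm i j]

/-- The free end of the path at `0`: there is no difference with the virtual vertex `-1`. -/
lemma screenedGreen_neg_one (m : ℕ) {j : ℤ} (hj : 0 ≤ j) :
    screenedGreen m (0 - 1) j = screenedGreen m 0 j := by
  have h1 : |(0 : ℤ) - 1 - j| = j + 1 := by rw [abs_of_nonpos (by omega)]; ring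
  have h2 : |(0 : ℤ) - j| = j := by rw [abs_of_nonpos (by omega)]; ring
  rw [screenedGreen, screenedGreen, h1, h2, ← ladderCosh_neg (m + 1 - (j + 1)),
    ← ladderCosh_neg (0 - 1 + j - m), add_comm (ladderCosh _)]
  congr 3 <;> ring_nf

/-- The free end of the path at `m`: there is no difference with the virtual vertex `m + 1`. -/
lemma screenedGreen_add_one (m : ℕ) {j : ℤ} (hj : j ≤ m) :
    screenedGreen m (m + 1) j = screenedGreen m m j := by
  have h1 : |(m : ℤ) + 1 - j| = m + 1 - j := abs_of_nonneg (by omega)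
  have h2 : |(m : ℤ) - j| = m - j := abs_of_nonneg (by omega)
  rw [screenedGreen, screenedGreen, h1, h2, add_comm (ladderCosh _)]
  congr 3 <;> ring_nf

lemma screenedGreen_recurrence (m : ℕ) (i j : ℤ) :
    4 * screenedGreen m i j - screenedGreen m (i - 1) j - screenedGreen m (i + 1) j =
      if i = j then 1 else 0 := by
  have hS : ladderSinh (m + 1) ≠ 0 := (ladderSinh_pos (by positivity)).ne'
  have h3 : √3 ≠ (0 : ℝ) := by positivity
  have hb : ladderCosh (i - 1 + j - m) + ladderCosh (i + 1 + j - m) =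
      4 * ladderCosh (i + j - m) := by
    rw [show i - 1 + j - m = i + j - m - 1 by ring, show i + 1 + j - m = i + j - m + 1 by ring,
      ladderCosh_add_one, ladderCosh_sub_one]; ring
  -- the absolute value has a corner at `i = j` only, and there it produces the Wronskian
  have ha : 4 * ladderCosh (m + 1 - |i - j|) - ladderCosh (m + 1 - |i - 1 - j|) -
      ladderCosh (m + 1 - |i + 1 - j|) = if i = j then 2 * √3 * ladderSinh (m + 1) else 0 := by
    split_ifs with h
    · subst h
      rw [show i - i = 0 by ring, show i - 1 - i = -1 by ring, show i + 1 - i = 1 by ring,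
        abs_neg, abs_one, abs_zero, sub_zero, ladderCosh_sub_one]
      ring
    · obtain ⟨q, h1, h2⟩ : ∃ q : ℤ, m + 1 - |i - j| = q ∧
          ((m + 1 - |i - 1 - j| = q + 1 ∧ m + 1 - |i + 1 - j| = q - 1) ∨
            (m + 1 - |i - 1 - j| = q - 1 ∧ m + 1 - |i + 1 - j| = q + 1)) := by
        refine ⟨_, rfl, ?_⟩
        rcases lt_or_gt_of_ne h with h | h
        · right
          rw [abs_of_nonpos (by omega), abs_of_nonpos (by omega), abs_of_nonpos (by omega)]
          constructor <;> ring
        · left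
          rw [abs_of_nonneg (by omega), abs_of_nonneg (by omega), abs_of_nonneg (by omega)]
          constructor <;> ring
      rcases h2 with ⟨h2, h4⟩ | ⟨h2, h4⟩ <;>
        rw [h1, h2, h4, ladderCosh_add_one, ladderCosh_sub_one] <;> ring
  have hsum : 4 * screenedGreen m i j - screenedGreen m (i - 1) j - screenedGreen m (i + 1) j =
      (if i = j then 2 * √3 * ladderSinh (m + 1) else 0) / (2 * √3 * ladderSinh (m + 1)) := by
    rw [screenedGreen, screenedGreen, screenedGreen, ← ha]
    field_simp
    linear_combination -hb
  rw [hsum]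
  split_ifs
  · rw [div_self (by positivity)]
  · simp

open MetrizedGraph in
/-- The Laplacian of the ladder acts as a second difference along the sides, with corrections at the
two ends for the missing edges, plus a rung term on the part depending on the side. -/
lemma graphLaplacian_ladderGraph (m : ℕ) (f : ℤ → ℝ) (g : ℤ → ℝ) (c : Fin 2 → ℝ)
    (i : Fin (m + 1)) (ε : Fin 2) :
    graphLaplacian (ladderGraph (m + 1)) (fun x => f (x.1 : ℕ) + c x.2 * g (x.1 : ℕ)) (i, ε) =
      (2 * f (i : ℕ) - f ((i : ℕ) - 1) - f ((i : ℕ) + 1)) +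
      c ε * (2 * g (i : ℕ) - g ((i : ℕ) - 1) - g ((i : ℕ) + 1)) +
      (c ε - c (1 - ε)) * g (i : ℕ) -
      (if (i : ℕ) = 0 then f 0 - f (0 - 1) + c ε * (g 0 - g (0 - 1)) else 0) -
      (if (i : ℕ) = m then f m - f (m + 1) + c ε * (g m - g (m + 1)) else 0) := by
  classical
  have h1 := sum_ladderGraph_adj (m + 1) i ε fun w => f (i : ℕ) + c ε * g (i : ℕ) -
    (f (w.1 : ℕ) + c w.2 * g (w.1 : ℕ))
  have h2 := sum_pathGraph_adj m (fun j => f (i : ℕ) + c ε * g (i : ℕ) - (f j + c ε * g j)) i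
  rw [graphLaplacian, h1, h2]
  obtain ⟨i, hi⟩ := i
  simp only
  rcases Nat.eq_zero_or_pos i with rfl | h0
  · rcases Nat.eq_zero_or_pos m with rfl | h3
    · simp; ring
    · simp [h3, h3.ne]; ring
  · rcases (Nat.lt_succ_iff.1 hi).lt_or_eq with h3 | rfl
    · simp [h0, h3, h3.ne, h0.ne']; ring
    · simp [h0, h0.ne']; ring

lemma abs_second_difference (i j : ℤ) :
    |((i - 1 : ℤ) : ℝ) - j| + |((i + 1 : ℤ) : ℝ) - j| - 2 * |(i : ℝ) - j| =
      if i = j then 2 else 0 := by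
  split_ifs with h
  · subst h; push_cast; norm_num
  · rcases lt_or_gt_of_ne h with h | h
    · have h' : (i : ℝ) + 1 ≤ j := by exact_mod_cast h
      push_cast
      rw [abs_of_nonpos (by linarith), abs_of_nonpos (by linarith), abs_of_nonpos (by linarith)]
      ring
    · have h' : (j : ℝ) + 1 ≤ i := by exact_mod_cast h
      push_cast
      rw [abs_of_nonneg (by linarith), abs_of_nonneg (by linarith), abs_of_nonneg (by linarith)]
      ring

lemma sum_cornerWeight_mul (m : ℕ) (F : Fin (m + 1) × Fin 2 → ℝ) :
    ∑ x, F x * cornerWeight m x =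
      (F (0, 0) + F (0, 1) + F (Fin.last m, 0) + F (Fin.last m, 1)) / 4 := by
  have h : ∀ (i : Fin (m + 1)) (ε : Fin 2), F (i, ε) * cornerWeight m (i, ε) =
      (if i = 0 then F (i, ε) / 4 else 0) + if i = Fin.last m then F (i, ε) / 4 else 0 := by
    intro i ε
    simp only [cornerWeight, Fin.ext_iff, Fin.val_zero, Fin.val_last]
    split_ifs <;> ring
  rw [Fintype.sum_prod_type_right]
  simp only [h, Finset.sum_add_distrib, Finset.sum_ite_eq', Finset.mem_univ, if_true,
    Fin.sum_univ_two]
  ring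

theorem isGreenMatrix_ladderGreen (m : ℕ) :
    MetrizedGraph.IsGreenMatrix (ladderGraph (m + 1)) (ladderGreen m) (cornerWeight m)
      (-(m : ℝ) / 8) where
  symm u v := by
    rw [ladderGreen, ladderGreen, abs_sub_comm, screenedGreen_comm]
    simp only [eq_comm]
  sum_weight := by
    have := sum_cornerWeight_mul m fun _ => 1
    simp only [one_mul] at this
    rw [this]; norm_num
  potential u := by
    rw [sum_cornerWeight_mul]
    obtain ⟨i, ε⟩ := u
    have h1 : (0 : ℝ) ≤ (i : ℕ) := by positivity
    have h2 : ((i : ℕ) : ℝ) ≤ m := by exact_mod_cast Nat.lt_succ_iff.1 i.2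
    simp only [ladderGreen, Fin.val_zero, Fin.val_last, Nat.cast_zero]
    rw [abs_of_nonneg (by linarith), abs_of_nonpos (by linarith)]
    fin_cases ε <;> simp <;> ring
  laplacian u v := by
    obtain ⟨i, ε⟩ := u
    obtain ⟨j, δ⟩ := v
    have h := graphLaplacian_ladderGraph m (fun k => -|(k : ℝ) - ((j : ℕ) : ℤ)| / 4)
      (fun k => screenedGreen m k (j : ℕ) / 2) (fun ε => if ε = δ then 1 else -1) i ε
    have hfun : (fun w => ladderGreen m w (j, δ)) = fun x : Fin (m + 1) × Fin 2 =>
        -|(((x.1 : ℕ) : ℤ) : ℝ) - ((j : ℕ) : ℤ)| / 4 +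
        (if x.2 = δ then 1 else -1) * (screenedGreen m (x.1 : ℕ) (j : ℕ) / 2) := by
      funext x
      simp only [ladderGreen, Int.cast_natCast]
      ring
    have hj0 : (0 : ℝ) ≤ (j : ℕ) := by positivity
    have hjm : ((j : ℕ) : ℝ) ≤ m := by exact_mod_cast Nat.lt_succ_iff.1 j.2
    have hjm' : ((j : ℕ) : ℤ) ≤ m := by exact_mod_cast Nat.lt_succ_iff.1 j.2
    have hrec := screenedGreen_recurrence m (i : ℕ) (j : ℕ)
    have habs := abs_second_difference (i : ℕ) (j : ℕ)
    have e1 : (-|((0 : ℤ) : ℝ) - ((j : ℕ) : ℤ)| / 4 - -|((0 - 1 : ℤ) : ℝ) - ((j : ℕ) : ℤ)| / 4) =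
        (1 / 4 : ℝ) := by
      push_cast
      rw [abs_of_nonpos (by linarith), abs_of_nonpos (by linarith)]; ring
    have e2 : (-|((m : ℤ) : ℝ) - ((j : ℕ) : ℤ)| / 4 -
        -|(((m : ℤ) + 1 : ℤ) : ℝ) - ((j : ℕ) : ℤ)| / 4) = (1 / 4 : ℝ) := by
      push_cast
      rw [abs_of_nonneg (by linarith), abs_of_nonneg (by linarith)]; ring
    rw [hfun, h, e1, e2, screenedGreen_neg_one m (by positivity), screenedGreen_add_one m hjm',
      sub_self, sub_self, mul_zero, add_zero, cornerWeight]
    have hc : ((if ε = δ then 1 else -1) - (if 1 - ε = δ then 1 else -1) : ℝ) =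
        2 * if ε = δ then 1 else -1 := by
      fin_cases ε <;> fin_cases δ <;> norm_num
    rw [hc]
    have hlhs : ((if ((i, ε) : Fin (m + 1) × Fin 2) = (j, δ) then 1 else 0) : ℝ) =
        (if ((i : ℕ) : ℤ) = (j : ℕ) then 2 else 0) / 4 +
          (if ε = δ then 1 else -1) * (if ((i : ℕ) : ℤ) = (j : ℕ) then 1 else 0) / 2 := by
      by_cases hij : i = j
      · subst hij
        by_cases hε : ε = δ
        · simp [hε]; norm_num
        · simp [hε]; norm_num
      · have : ¬ (i : ℕ) = (j : ℕ) := fun h => hij (Fin.ext h)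
        simp [hij, this]
    have hρ : (((if (i : ℕ) = 0 then 1 else 0) + if (i : ℕ) = m then 1 else 0) / 4 : ℝ) =
        (if (i : ℕ) = 0 then 1 / 4 else 0) + if (i : ℕ) = m then 1 / 4 else 0 := by
      split_ifs <;> norm_num
    rw [hlhs, ← hrec, ← habs, hρ]
    ring

/-! ### The tau constant of the ladder -/

lemma screenedGreen_self (m : ℕ) (i : ℤ) :
    screenedGreen m i i = (ladderCosh (m + 1) + ladderCosh (2 * i + -m)) /
      (2 * √3 * ladderSinh (m + 1)) := by
  rw [screenedGreen, sub_self, abs_zero, sub_zero]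
  congr 3; ring

lemma screenedGreen_self_sub (m : ℕ) (i : ℤ) :
    screenedGreen m i i - screenedGreen m (i + 1) (i + 1) =
      -ladderSinh (2 * i + (1 - m)) / ladderSinh (m + 1) := by
  have hS : ladderSinh (m + 1) ≠ 0 := (ladderSinh_pos (by positivity)).ne'
  have h3 : √3 ≠ (0 : ℝ) := by positivity
  rw [screenedGreen_self, screenedGreen_self,
    show 2 * i + -(m : ℤ) = 2 * i + (1 - m) - 1 by ring,
    show 2 * (i + 1) + -(m : ℤ) = 2 * i + (1 - m) + 1 by ring,
    ladderCosh_add_one (2 * i + (1 - m)), ladderCosh_sub_one (2 * i + (1 - m))]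
  field_simp
  ring

/-- The deviation from `1` of the effective resistance for `L + 2` between consecutive vertices of
the path. -/
lemma one_sub_screenedGreen (m : ℕ) (i : ℤ) :
    1 - (screenedGreen m i i + screenedGreen m (i + 1) (i + 1) - 2 * screenedGreen m i (i + 1)) =
      √3 / 3 * (ladderCosh (m + 1) - ladderCosh (2 * i + (1 - m))) / ladderSinh (m + 1) := by
  have hS : ladderSinh (m + 1) ≠ 0 := (ladderSinh_pos (by positivity)).ne'
  have h3 : √3 ≠ (0 : ℝ) := by positivity
  have h4 : screenedGreen m i (i + 1) = (2 * ladderCosh (m + 1) - √3 * ladderSinh (m + 1) +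
      ladderCosh (2 * i + (1 - m))) / (2 * √3 * ladderSinh (m + 1)) := by
    rw [screenedGreen, show i - (i + 1) = -1 by ring, abs_neg, abs_one, ladderCosh_sub_one]
    congr 3; ring
  rw [h4, screenedGreen_self, screenedGreen_self,
    show 2 * i + -(m : ℤ) = 2 * i + (1 - m) - 1 by ring,
    show 2 * (i + 1) + -(m : ℤ) = 2 * i + (1 - m) + 1 by ring,
    ladderCosh_add_one (2 * i + (1 - m)), ladderCosh_sub_one (2 * i + (1 - m))]
  field_simp
  linear_combination (-2 : ℝ) * (ladderCosh (m + 1) - ladderCosh (2 * i + (1 - m))) * sqrt_three_sq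

/-- The contribution of the sides of the ladder to the tau constant. -/
lemma sum_screenedGreen_sides (m : ℕ) :
    ∑ i ∈ Finset.range m, (1 / 8 * (screenedGreen m i i - screenedGreen m (i + 1) (i + 1)) ^ 2 +
      1 / 24 * (1 - (screenedGreen m i i + screenedGreen m (i + 1) (i + 1) -
        2 * screenedGreen m i (i + 1))) ^ 2) =
      1 / (72 * ladderSinh (m + 1) ^ 2) *
        (10 * (2 * m + √3 / 12 * ((2 * ladderSinh (m + 1) - √3 * ladderCosh (m + 1)) *
          (2 * ladderCosh (m + 1) - √3 * ladderSinh (m + 1)))) -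
        2 * ladderCosh (m + 1) *
          (√3 / 3 * (2 * ladderSinh (m + 1) - √3 * ladderCosh (m + 1))) +
        m * (ladderCosh (m + 1) ^ 2 - 36)) := by
  have hS : ladderSinh (m + 1) ≠ 0 := (ladderSinh_pos (by positivity)).ne'
  have h1 := sum_ladderCosh m (1 - m)
  have h2 := sum_ladderCosh_sq m (1 - m)
  have e1 : ladderSinh m = 2 * ladderSinh (m + 1) - √3 * ladderCosh (m + 1) := by
    rw [← ladderSinh_sub_one]; congr 1; ring
  have e2 : ladderCosh m = 2 * ladderCosh (m + 1) - √3 * ladderSinh (m + 1) := by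
    rw [← ladderCosh_sub_one]; congr 1; ring
  rw [show 2 * (m : ℤ) + (1 - m) - 1 = m by ring, show 1 - (m : ℤ) - 1 = -m by ring,
    ladderSinh_neg, e1] at h1
  rw [show 2 * (m : ℤ) + (1 - m) - 1 = m by ring, show 1 - (m : ℤ) - 1 = -m by ring,
    mul_neg, ladderSinh_neg, ladderSinh_two_mul, e1, e2] at h2
  have hterm : ∀ i ∈ Finset.range m,
      1 / 8 * (screenedGreen m i i - screenedGreen m (i + 1) (i + 1)) ^ 2 +
      1 / 24 * (1 - (screenedGreen m i i + screenedGreen m (i + 1) (i + 1) -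
        2 * screenedGreen m i (i + 1))) ^ 2 =
      1 / (72 * ladderSinh (m + 1) ^ 2) * (10 * ladderCosh (2 * i + (1 - m)) ^ 2 -
        2 * ladderCosh (m + 1) * ladderCosh (2 * i + (1 - m)) +
        (ladderCosh (m + 1) ^ 2 - 36)) := by
    intro i _
    rw [screenedGreen_self_sub, one_sub_screenedGreen, div_pow, neg_sq, ← sub_eq_of_eq_add
      (ladderCosh_sq (2 * i + (1 - m)))]
    field_simp
    linear_combination 576 * (ladderCosh (m + 1) - ladderCosh (2 * i + (1 - m))) ^ 2 * sqrt_three_sq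
  rw [Finset.sum_congr rfl hterm, ← Finset.mul_sum, Finset.sum_add_distrib, Finset.sum_sub_distrib,
    ← Finset.mul_sum, ← Finset.mul_sum, h1, h2, Finset.sum_const, Finset.card_range, nsmul_eq_mul]
  ring

/-- The contribution of the rungs of the ladder to the tau constant. -/
lemma sum_screenedGreen_rungs (m : ℕ) :
    ∑ i ∈ Finset.range (m + 1), 1 / 12 * (1 - 2 * screenedGreen m i i) ^ 2 =
      1 / (36 * ladderSinh (m + 1) ^ 2) *
        ((m + 1) * (√3 * ladderSinh (m + 1) - ladderCosh (m + 1)) ^ 2 -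
        2 * (√3 * ladderSinh (m + 1) - ladderCosh (m + 1)) * (√3 / 3 * ladderSinh (m + 1)) +
        (2 * (m + 1) + √3 / 12 * (ladderSinh (m + 1) * ladderCosh (m + 1)))) := by
  have hS : ladderSinh (m + 1) ≠ 0 := (ladderSinh_pos (by positivity)).ne'
  have h3 : √3 ≠ (0 : ℝ) := by positivity
  have h1 := sum_ladderCosh (m + 1) (-m)
  have h2 := sum_ladderCosh_sq (m + 1) (-m)
  push_cast at h1 h2
  rw [show 2 * ((m : ℤ) + 1) + -m - 1 = m + 1 by ring, show -(m : ℤ) - 1 = -(m + 1) by ring,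
    ladderSinh_neg] at h1
  rw [show 2 * ((m : ℤ) + 1) + -m - 1 = m + 1 by ring, show -(m : ℤ) - 1 = -(m + 1) by ring,
    mul_neg, ladderSinh_neg, ladderSinh_two_mul] at h2
  have hterm : ∀ i ∈ Finset.range (m + 1), 1 / 12 * (1 - 2 * screenedGreen m i i) ^ 2 =
      1 / (36 * ladderSinh (m + 1) ^ 2) *
        ((√3 * ladderSinh (m + 1) - ladderCosh (m + 1)) ^ 2 -
          2 * (√3 * ladderSinh (m + 1) - ladderCosh (m + 1)) * ladderCosh (2 * i + -m) +
          ladderCosh (2 * i + -m) ^ 2) := by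
    intro i _
    rw [screenedGreen_self]
    field_simp
    linear_combination (-12 : ℝ) * (√3 * ladderSinh (m + 1) - ladderCosh (m + 1) -
      ladderCosh (2 * i + -m)) ^ 2 * sqrt_three_sq
  rw [Finset.sum_congr rfl hterm, ← Finset.mul_sum, Finset.sum_add_distrib, Finset.sum_sub_distrib,
    ← Finset.mul_sum, h1, h2, Finset.sum_const, Finset.card_range, nsmul_eq_mul]
  push_cast
  ring

/-- The closed form for the ladder with `m + 1` rungs, as a rational function of `s (m + 1)` and
`c (m + 1)`: the two sides agree modulo `√3 ^ 2 = 3` and `C ^ 2 = S ^ 2 + 4`. -/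
lemma ladder_closed_form {S C : ℝ} (m : ℝ) (hS : S ≠ 0) (hCS : C ^ 2 = S ^ 2 + 4) :
    1 / 2 * ((3 * C - √3 * S) / (2 * √3 * S)) + m / 8 +
      1 / (72 * S ^ 2) * (10 * (2 * m + √3 / 12 * ((2 * S - √3 * C) * (2 * C - √3 * S))) -
        2 * C * (√3 / 3 * (2 * S - √3 * C)) + m * (C ^ 2 - 36)) +
      1 / (36 * S ^ 2) * ((m + 1) * (√3 * S - C) ^ 2 -
        2 * (√3 * S - C) * (√3 / 3 * S) + (2 * (m + 1) + √3 / 12 * (S * C))) =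
    (9 * (m + 1) - 20) / 36 + (m + 1 - 6) / (6 * √3) * (-C / S) := by
  have h3 : √3 ≠ (0 : ℝ) := by positivity
  have hr := sqrt_three_sq
  have e1 : (3 * C - √3 * S) / (2 * √3 * S) = (√3 * C - S) / (2 * S) := by
    field_simp
    linear_combination -C * hr
  have e2 : (m + 1 - 6) / (6 * √3) = (m + 1 - 6) * √3 / 18 := by
    field_simp
    linear_combination (30 - 6 * m) * hr
  rw [e1, e2]
  have key : 18 * S * (√3 * C - S) + 9 * m * S ^ 2 +
      (10 * (2 * m + √3 / 12 * ((2 * S - √3 * C) * (2 * C - √3 * S))) -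
        2 * C * (√3 / 3 * (2 * S - √3 * C)) + m * (C ^ 2 - 36)) +
      2 * ((m + 1) * (√3 * S - C) ^ 2 -
        2 * (√3 * S - C) * (√3 / 3 * S) + (2 * (m + 1) + √3 / 12 * (S * C))) -
      2 * S ^ 2 * (9 * m - 11) + 4 * (m - 5) * √3 * C * S = 0 := by
    linear_combination (3 * m - 1) * hCS + (-(5 / 3) * (S ^ 2 + C ^ 2) + 5 / 6 * √3 * S * C +
      2 / 3 * C ^ 2 + 2 * (m + 1) * S ^ 2 - 4 / 3 * S ^ 2) * hr
  rw [← sub_eq_zero, ← zero_div (72 * S ^ 2), ← key]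
  field_simp
  ring

lemma one_sub_two_div_eq (m : ℕ) :
    1 - 2 / (1 - (2 - √3) ^ (2 * (m + 1))) = -ladderCosh (m + 1) / ladderSinh (m + 1) := by
  have hS := ladderSinh_pos (k := (m : ℤ) + 1) (by positivity)
  have hc : ((m : ℤ) + 1) = ((m + 1 : ℕ) : ℤ) := by push_cast; rfl
  have hx : (0 : ℝ) < (2 + √3) ^ (m + 1) := by positivity
  have hy : (2 + √3) ^ (m + 1) * (2 - √3) ^ (m + 1) = (1 : ℝ) := by
    rw [← mul_pow, show (2 + √3) * (2 - √3) = (1 : ℝ) by linear_combination -sqrt_three_sq, one_pow]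
  have hi : ((2 + √3) ^ (m + 1))⁻¹ = ((2 - √3) ^ (m + 1) : ℝ) := inv_eq_of_mul_eq_one_right hy
  rw [ladderSinh, hc, zpow_neg, zpow_natCast, hi] at hS
  rw [ladderCosh, ladderSinh, hc, zpow_neg, zpow_natCast, hi, mul_comm 2 (m + 1), pow_mul]
  generalize (2 + √3 : ℝ) ^ (m + 1) = x at *
  generalize (2 - √3 : ℝ) ^ (m + 1) = y at *
  have h1 : 1 - y ^ 2 ≠ 0 := by
    have : x * (1 - y ^ 2) = x - y := by linear_combination -y * hy
    intro h0
    rw [h0, mul_zero] at this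
    linarith
  rw [eq_div_iff hS.ne', one_sub_div h1, div_mul_eq_mul_div, div_eq_iff h1]
  linear_combination -2 * y * hy

lemma ladderGraph_connected (m : ℕ) : (ladderGraph (m + 1)).Connected :=
  (SimpleGraph.pathGraph_connected m).boxProd (SimpleGraph.pathGraph_connected 1)

theorem isTauConstant_ladderGraph (m : ℕ) :
    IsTauConstant (ladderGraph (m + 1))
      ((9 * ((m : ℝ) + 1) - 20) / 36 + ((m : ℝ) + 1 - 6) / (6 * √3) *
        (-ladderCosh (m + 1) / ladderSinh (m + 1))) := by
  classical
  have hS : ladderSinh (m + 1) ≠ 0 := (ladderSinh_pos (by positivity)).ne'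
  have h := MetrizedGraph.isTauConstant_of_isGreenMatrix (ladderGraph_connected m)
    (isGreenMatrix_ladderGreen m)
  have hdiag : ∀ (i : Fin (m + 1)) (ε : Fin 2),
      ladderGreen m (i, ε) (i, ε) = screenedGreen m (i : ℕ) (i : ℕ) / 2 := by
    intro i ε; simp [ladderGreen]
  have hcorner : ∑ u, cornerWeight m u * ladderGreen m u u =
      1 / 2 * ((3 * ladderCosh (m + 1) - √3 * ladderSinh (m + 1)) /
        (2 * √3 * ladderSinh (m + 1))) := by
    simp only [mul_comm (cornerWeight m _)]
    rw [sum_cornerWeight_mul m fun u => ladderGreen m u u]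
    simp only [hdiag, Fin.val_zero, Fin.val_last, screenedGreen_self]
    rw [show 2 * ((0 : ℕ) : ℤ) + -(m : ℤ) = -m by simp, show 2 * (m : ℤ) + -m = m by ring,
      ladderCosh_neg, show ladderCosh m = 2 * ladderCosh (m + 1) - √3 * ladderSinh (m + 1) by
        rw [← ladderCosh_sub_one]; congr 1; ring]
    ring
  have hsq := sum_sum_ladderGraph_adj m
    (fun u w => (ladderGreen m u u - ladderGreen m w w) ^ 2)
    (fun i j => (screenedGreen m i i / 2 - screenedGreen m j j / 2) ^ 2) (fun _ => 0)
    (fun i j => by ring) (fun i j ε => by simp only [hdiag])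
    (fun i ε => by simp only [hdiag]; ring)
  have hres := sum_sum_ladderGraph_adj m
    (fun u w => (1 - MetrizedGraph.resistance (ladderGreen m) u w) ^ 2)
    (fun i j => (1 - (screenedGreen m i i / 2 + screenedGreen m j j / 2 -
      2 * (-|(i : ℝ) - j| / 4 + screenedGreen m i j / 2))) ^ 2)
    (fun i => (1 - 2 * screenedGreen m i i) ^ 2)
    (fun i j => by rw [abs_sub_comm, screenedGreen_comm m i j]; ring)
    (fun i j ε => by
      rw [MetrizedGraph.resistance, hdiag, hdiag, ladderGreen]; simp)
    (fun i ε => by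
      rw [MetrizedGraph.resistance, hdiag, hdiag, ladderGreen]
      fin_cases ε <;> simp <;> ring)
  rw [hcorner, hsq, hres] at h
  convert h using 1
  have hsides := sum_screenedGreen_sides m
  have hrungs := sum_screenedGreen_rungs m
  have hclosed := ladder_closed_form (m : ℝ) hS (ladderCosh_sq (m + 1))
  rw [← hsides, ← hrungs] at hclosed
  rw [← hclosed]
  have habs : ∀ i : ℕ, |(((i : ℕ) : ℤ) : ℝ) - (((i : ℤ) + 1 : ℤ) : ℝ)| = 1 := by
    intro i; push_cast; rw [abs_of_nonpos (by linarith)]; ring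
  simp only [habs, Finset.sum_add_distrib, ← Finset.mul_sum, Finset.sum_const_zero]
  have g1 : ∀ i : ℕ, (screenedGreen m i i / 2 - screenedGreen m (i + 1) (i + 1) / 2) ^ 2 =
      1 / 4 * (screenedGreen m i i - screenedGreen m (i + 1) (i + 1)) ^ 2 := by
    intro i; ring
  have g2 : ∀ i : ℕ, (1 - (screenedGreen m i i / 2 + screenedGreen m (i + 1) (i + 1) / 2 -
      2 * (-1 / 4 + screenedGreen m i (i + 1) / 2))) ^ 2 =
      1 / 4 * (1 - (screenedGreen m i i + screenedGreen m (i + 1) (i + 1) -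
        2 * screenedGreen m i (i + 1))) ^ 2 := by
    intro i; ring
  simp only [g1, g2, ← Finset.mul_sum]
  ring

theorem theorem4p2 (n : ℕ) (hn : 1 ≤ n) :
    IsTauConstant (ladderGraph n)
      ((9 * (n : ℝ) - 20) / 36 + ((n : ℝ) - 6) / (6 * Real.sqrt 3) *
        (1 - 2 / (1 - (2 - Real.sqrt 3) ^ (2 * n)))) := by
  obtain ⟨m, rfl⟩ : ∃ m, n = m + 1 := ⟨n - 1, by omega⟩
  rw [one_sub_two_div_eq]
  push_cast
  exact isTauConstant_ladderGraph m
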